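/- **Setting.** Consider one of two supervised tasks with hyperparameter $\theta\in\Theta$ and local loss $v$: * quantile regression (QR): $\Theta=[0,1]$, $v(\theta,y,t)=\max\big(\theta(y-t),(\theta-1)(y-t)\big)$, and $|Y|\le B$ almost surely; * cost-sensitive classification (CSC): $\Theta=[-1,1]$, $v(\theta,y,t)=\big|\tfrac{\theta+1}{2}-\mathbf 1_{\{-1\}}(y)\big|\max(1-yt,0)$, and $Y\in\{-1,1\}$ almost surely. Let $(X,Y)$ have law $P$ on $\mathcal X\times\mathbb R$, where $\mathcal X$ is a measurable space. Let $k_{\mathcal X}$ be a jointly measurable real kernel on $\mathcal X$ with $k_{\mathcal X}(x,x)\le\kappa_{\mathcal X}^2$ for all $x$, and let $k_\Theta$ be a real kernel on $\Theta$, of class $C^1$ on $\Theta\times\Theta$ (so that its partial derivatives are bounded), with $k_\Theta(\theta,\theta)\le\kappa_\Theta^2$ for all $\theta$. Let $\mathcal H_{k_\Theta}$ be the RKHS of $k_\Theta$ and $\mathcal H_K$ the vector-valued RKHS of functions $\mathcal X\to\mathcal H_{k_\Theta}$ with kernel $K(x,z)=k_{\mathcal X}(x,z)\,I_{\mathcal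 H_{k_\Theta}}$. Let $\mu$ be a probability measure on $\Theta$ with distribution function $F$, and $F^{-1}(u)=\inf\{t\in\Theta: u\le F(t)\}$. Let $u_0,u_1,\dots$ be the one-dimensional Sobol sequence (if $j=\sum_i b_i2^i$ in binary, then $u_j=\sum_i b_i2^{-i-1}$), and $\theta_j=F^{-1}(u_j)$; for $\mu$ uniform on $[0,1]$ this is $\theta_j=u_j$. For $S=((x_i,y_i))_{i=1}^n$ and $h\in\mathcal H_K$ put $$R(h)=\mathbb E_{X,Y}\Big[\int_\Theta v\big(\theta,Y,h(X)(\theta)\big)\,d\mu(\theta)\Big],\qquad \widetilde R_S(h)=\frac1n\sum_{i=1}^n\frac1m\sum_{j=0}^{m-1}v\big(\theta_j,y_i,h(x_i)(\theta_j)\big).$$ **Proposition (Generalization).** For all $\lambda>0$, $n$, $m$ and $S$ the problem $$\min_{h\in\mathcal H_K}\ \widetilde R_S(h)+\tfrac{\lambda}{2}\|h\|_{\mathcal H_K}^2$$ has exactly one solution $h^*=h^*_S$. If $S\sim P^{\otimes n}$, then $$R(h^*)\le\widetilde R_S(h^*)+O_{P}\Big(\frac1{\sqrt{\lambda n}}\Big)+O\Big(\frac{\log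 m}{\sqrt\lambda\, m}\Big),$$ in the following sense. For all $\kappa_{\mathcal X},\kappa_\Theta,B,D,\Lambda$ there are a constant $C_2$ and constants $C_1(\delta)$, $\delta>0$, depending on nothing else but the task, such that the inequality $$R(h^*)\le\widetilde R_S(h^*)+\frac{C_1(\delta)}{\sqrt{\lambda n}}+C_2\frac{\log m}{\sqrt\lambda\,m}\qquad(*)$$ fails with (outer) probability at most $\delta$ in each of the following cases: 1. $\mu$ is uniform on $\Theta$, $0<\lambda\le\Lambda$, $n\ge1$, $\delta>0$ and $m\ge M$, where $M$ depends on $P$, the kernels and $\lambda$, but not on $n$ or $\delta$; 2. $\mu$ is any probability measure on $\Theta$, $0<\lambda\le\Lambda$, $n\ge1$, $m\ge2$, $\delta>0$ are arbitrary, and in addition $\theta\mapsto k_\Theta(\theta,\cdot)\in\mathcal H_{k_\Theta}$ is $D$-Lipschitz, i.e. $k_\Theta(s,s)+k_\Theta(t,t)-2k_\Theta(s,t)\le D^2(s-t)^2$ for all $s,t\in\Theta$ (for example $k_\Theta$ of class $C^2$ with $|\partial_1\partial_2k_\Theta|\le D^2$). -/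

import Mathlib

open MeasureTheory

noncomputable section

namespace InfiniteTask

/-- The two supervised parametrized tasks: quantile regression and cost-sensitive
classification. -/
inductive Task
  | quantileRegression
  | costSensitive

namespace Task

/-- Left end point of the hyperparameter interval. -/
def lo : Task → ℝ
  | quantileRegression => 0
  | costSensitive => -1

/-- Right end point of the hyperparameter interval. -/
def hi : Task → ℝ
  | quantileRegression => 1
  | costSensitive => 1

theorem lo_le_hi (τ : Task) : τ.lo ≤ τ.hi := by
  cases τ <;> norm_num [lo, hi]

/-- The hyperparameter space: `[0, 1]` for quantile regression, `[-1, 1]` for cost-sensitive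
classification. -/
abbrev Hyper (τ : Task) : Type := Set.Icc τ.lo τ.hi

/-- The local loss `v(θ, y, t)`: the pinball loss, respectively the cost-sensitive hinge loss. -/
def loss : Task → ℝ → ℝ → ℝ → ℝ
  | quantileRegression, θ, y, t => max (θ * (y - t)) ((θ - 1) * (y - t))
  | costSensitive, θ, y, t =>
      |(θ + 1) / 2 - Set.indicator {(-1 : ℝ)} (fun _ => 1) y| * max (1 - y * t) 0

/-- The admissible outputs: `[-B, B]` for quantile regression, `{-1, 1}` for cost-sensitive
classification. -/
def outputs (B : ℝ) : Task → Set ℝ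
  | quantileRegression => Set.Icc (-B) B
  | costSensitive => {-1, 1}

/-- The uniform probability measure on the hyperparameter interval. -/
def uniform (τ : Task) : Measure τ.Hyper :=
  (ENNReal.ofReal (τ.hi - τ.lo))⁻¹ • Measure.comap (Subtype.val : τ.Hyper → ℝ) volume

end Task

/-- The one-dimensional Sobol sequence (the base `2` radical inverse): the binary digits of `j`
are reflected at the binary point. -/
def sobol (j : ℕ) : ℝ :=
  ∑ i ∈ Finset.range j.size, if j.testBit i then (1 / 2 : ℝ) ^ (i + 1) else 0

/-- The generalized inverse `F⁻¹(u) = inf {t | u ≤ F(t)}`, for `0 ≤ u ≤ 1`, of the distribution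
function `F` of `μ`. For such `u` the infimum lies in the hyperparameter interval, so that the
projection onto the interval only serves to give the value its type. -/
def quantile (τ : Task) (μ : Measure τ.Hyper) (u : ℝ) : τ.Hyper :=
  Set.projIcc τ.lo τ.hi τ.lo_le_hi
    (sInf {t : ℝ | τ.lo ≤ t ∧ u ≤ μ.real {s : τ.Hyper | (s : ℝ) ≤ t}})

/-- The quasi-Monte Carlo nodes for `μ`: the Sobol points transported by `F⁻¹`. -/
def node (τ : Task) (μ : Measure τ.Hyper) (j : ℕ) : τ.Hyper :=
  quantile τ μ (sobol j)

section Risk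

variable {𝒳 HΘ H : Type*} (τ : Task)
  [NormedAddCommGroup HΘ] [InnerProductSpace ℝ HΘ] [RKHS ℝ HΘ τ.Hyper ℝ]
  [NormedAddCommGroup H] [InnerProductSpace ℝ H] [RKHS ℝ H 𝒳 HΘ]

/-- The integrated loss `V(y, h(x)) = ∫ v(θ, y, h(x)(θ)) dμ(θ)`. -/
def integratedLoss (μ : Measure τ.Hyper) (y : ℝ) (f : HΘ) : ℝ :=
  ∫ θ : τ.Hyper, τ.loss θ y (f θ) ∂μ

/-- The sampled loss, with `m` quasi-Monte Carlo nodes. -/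
def sampledLoss (μ : Measure τ.Hyper) (m : ℕ) (y : ℝ) (f : HΘ) : ℝ :=
  (1 / m : ℝ) * ∑ j ∈ Finset.range m, τ.loss (node τ μ j) y (f (node τ μ j))

/-- The true risk `R(h)`. -/
def risk [MeasurableSpace 𝒳] (μ : Measure τ.Hyper) (P : Measure (𝒳 × ℝ)) (h : H) : ℝ :=
  ∫ z : 𝒳 × ℝ, integratedLoss τ μ z.2 (h z.1) ∂P

/-- The sampled empirical risk of `h` on the training set `S`. -/
def sampledEmpiricalRisk (μ : Measure τ.Hyper) (m : ℕ) {n : ℕ} (S : Fin n → 𝒳 × ℝ) (h : H) : ℝ :=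
  (1 / n : ℝ) * ∑ i : Fin n, sampledLoss τ μ m (S i).2 (h (S i).1)

/-- `h` minimizes the ridge-regularized sampled empirical risk over the hypothesis space `H`. -/
def IsSolution (μ : Measure τ.Hyper) (lam : ℝ) (m : ℕ) {n : ℕ} (S : Fin n → 𝒳 × ℝ) (h : H) :
    Prop :=
  ∀ g : H, sampledEmpiricalRisk τ μ m S h + lam / 2 * ‖h‖ ^ 2 ≤
    sampledEmpiricalRisk τ μ m S g + lam / 2 * ‖g‖ ^ 2

end Risk

end InfiniteTask

end

noncomputable section

namespace InfiniteTask

section VanDerCorput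

theorem sobol_eq_sum {j N : ℕ} (h : j < 2 ^ N) :
    sobol j = ∑ i ∈ Finset.range N, if j.testBit i then (1 / 2 : ℝ) ^ (i + 1) else 0 := by
  refine Finset.sum_subset (by simpa using Nat.size_le.2 h) fun i _ hi => ?_
  have hij : j < 2 ^ i := Nat.size_le.1 (by simpa using hi)
  simp [Nat.testBit_lt_two_pow hij]

@[simp]
theorem sobol_zero : sobol 0 = 0 := by simp [sobol]

theorem sobol_two_mul (j : ℕ) : sobol (2 * j) = sobol j / 2 := by
  have h1 : j < 2 ^ j := Nat.lt_two_pow_self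
  have h2 : 2 * j < 2 ^ (j + 1) := by rw [pow_succ]; omega
  rw [sobol_eq_sum h1, sobol_eq_sum h2, Finset.sum_range_succ', Finset.sum_div]
  simp only [Nat.testBit_succ, Nat.testBit_zero]
  simp only [Nat.mul_mod_right, Nat.mul_div_cancel_left j two_pos, zero_ne_one, decide_false,
    Bool.false_eq_true, if_false, add_zero]
  refine Finset.sum_congr rfl fun i _ => ?_
  split_ifs
  · rw [pow_succ]; ring
  · simp

theorem sobol_two_mul_add_one (j : ℕ) : sobol (2 * j + 1) = (1 + sobol j) / 2 := by
  have h1 : j < 2 ^ j := Nat.lt_two_pow_self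
  have h2 : 2 * j + 1 < 2 ^ (j + 1) := by rw [pow_succ]; omega
  have h3 : (2 * j + 1) / 2 = j := by omega
  have h4 : (2 * j + 1) % 2 = 1 := by omega
  rw [sobol_eq_sum h1, sobol_eq_sum h2, Finset.sum_range_succ', add_div, add_comm, Finset.sum_div]
  simp only [Nat.testBit_succ, Nat.testBit_zero, h3, h4]
  simp only [decide_true, if_true, zero_add, pow_one]
  congr 1
  refine Finset.sum_congr rfl fun i _ => ?_
  split_ifs
  · rw [pow_succ]; ring
  · simp

theorem sobol_mem_Ico (j : ℕ) : sobol j ∈ Set.Ico (0 : ℝ) 1 := by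
  induction j using Nat.strong_induction_on with
  | _ j ih =>
    rcases Nat.eq_zero_or_pos j with rfl | hj
    · simp
    obtain ⟨h0, h1⟩ := ih (j / 2) (by omega)
    rcases Nat.mod_two_eq_zero_or_one j with h | h
    · rw [show j = 2 * (j / 2) by omega, sobol_two_mul]
      exact ⟨by linarith, by linarith⟩
    · rw [show j = 2 * (j / 2) + 1 by omega, sobol_two_mul_add_one]
      exact ⟨by linarith, by linarith⟩

/-- The sum of `G` over the grid of mesh `2⁻ᵏ` with offset `x`. -/
def gridSum (k : ℕ) (G : ℝ → ℝ) (x : ℝ) : ℝ :=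
  ∑ l ∈ Finset.range (2 ^ k), G ((l + x) / 2 ^ k)

theorem gridSum_zero (G : ℝ → ℝ) (x : ℝ) : gridSum 0 G x = G x := by simp [gridSum]

theorem gridSum_gridSum_one (k : ℕ) (G : ℝ → ℝ) (x : ℝ) :
    gridSum k (fun y => G (y / 2) + G ((1 + y) / 2)) x = gridSum (k + 1) G x := by
  unfold gridSum
  rw [show 2 ^ (k + 1) = 2 ^ k + 2 ^ k by ring, Finset.sum_range_add, ← Finset.sum_add_distrib]
  refine Finset.sum_congr rfl fun l _ => ?_
  have h1 : ((l : ℝ) + x) / 2 ^ k / 2 = (l + x) / 2 ^ (k + 1) := by rw [div_div, ← pow_succ]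
  have h2 : (1 + ((l : ℝ) + x) / 2 ^ k) / 2 = (((2 ^ k + l : ℕ) : ℝ) + x) / 2 ^ (k + 1) := by
    push_cast; rw [pow_succ]; field_simp; ring
  rw [← h1, ← h2]

theorem sum_sobol_two_mul (G : ℝ → ℝ) (m : ℕ) :
    ∑ j ∈ Finset.range (2 * m), G (sobol j) =
      ∑ j ∈ Finset.range m, (G (sobol j / 2) + G ((1 + sobol j) / 2)) := by
  induction m with
  | zero => simp
  | succ m ih =>
    rw [show 2 * (m + 1) = 2 * m + 1 + 1 by ring, Finset.sum_range_succ, Finset.sum_range_succ, ih,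
      Finset.sum_range_succ, sobol_two_mul, sobol_two_mul_add_one]
    ring

theorem abs_sub_integral_le {G : ℝ → ℝ} (hG : IntervalIntegrable G volume 0 1) {β : ℝ}
    (hβ : ∀ x ∈ Set.Ico (0 : ℝ) 1, ∀ x' ∈ Set.Ico (0 : ℝ) 1, |G x - G x'| ≤ β)
    {x : ℝ} (hx : x ∈ Set.Ico (0 : ℝ) 1) : |G x - ∫ t in (0 : ℝ)..1, G t| ≤ β := by
  have h1 : G x - ∫ t in (0 : ℝ)..1, G t = ∫ t in (0 : ℝ)..1, (G x - G t) := by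
    rw [intervalIntegral.integral_sub (by simp) hG]; simp
  rw [h1]
  have h2 := intervalIntegral.norm_integral_le_of_norm_le_const_ae (a := (0 : ℝ)) (b := 1)
    (f := fun t => G x - G t) (C := β) (by
      have : ∀ᵐ t : ℝ, t ≠ 1 := by simp [ae_iff]
      filter_upwards [this] with t ht hmem
      rw [Set.uIoc_of_le zero_le_one] at hmem
      exact hβ x hx t ⟨hmem.1.le, lt_of_le_of_ne hmem.2 ht⟩)
  simpa using h2

theorem abs_sum_sobol_sub_le (N : ℕ) : ∀ (G : ℝ → ℝ), IntervalIntegrable G volume 0 1 →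
    ∀ β : ℕ → ℝ, (∀ k, ∀ x ∈ Set.Ico (0 : ℝ) 1, ∀ x' ∈ Set.Ico (0 : ℝ) 1,
      |gridSum k G x - gridSum k G x'| ≤ β k) → ∀ m < 2 ^ N,
    |∑ j ∈ Finset.range m, G (sobol j) - m * ∫ t in (0 : ℝ)..1, G t|
      ≤ ∑ k ∈ Finset.range N, β k := by
  induction N with
  | zero =>
    intro G _ β _ m hm
    obtain rfl : m = 0 := by simpa using hm
    simp
  | succ N ih =>
    intro G hG β hβ m hm
    set G' : ℝ → ℝ := fun y => G (y / 2) + G ((1 + y) / 2) with hG'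
    have hl : IntervalIntegrable (fun y => G (y / 2)) volume 0 1 := by
      have := (hG.mono_set (a := 0) (b := 1) (c := 0) (d := 1 / 2) (by
        rw [Set.uIcc_of_le (by norm_num), Set.uIcc_of_le (by norm_num)]
        exact Set.Icc_subset_Icc le_rfl (by norm_num))).comp_mul_right (c := (1 / 2 : ℝ))
      norm_num at this
      simpa [div_eq_mul_inv] using this
    have hr : IntervalIntegrable (fun y => G ((1 + y) / 2)) volume 0 1 := by
      have h1 := (hG.mono_set (a := 0) (b := 1) (c := 1 / 2) (d := 1) (by
        rw [Set.uIcc_of_le (by norm_num), Set.uIcc_of_le (by norm_num)]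
        exact Set.Icc_subset_Icc (by norm_num) le_rfl)).comp_mul_right (c := (1 / 2 : ℝ))
      have h2 := h1.comp_add_left 1
      norm_num at h2
      simpa [div_eq_mul_inv] using h2
    have hintegr : ∫ t in (0 : ℝ)..1, G' t = 2 * ∫ t in (0 : ℝ)..1, G t := by
      have h1 : ∫ t in (0 : ℝ)..1, G (t / 2) = 2 * ∫ t in (0 : ℝ)..(1 / 2), G t := by
        simp
      have h2 : ∫ t in (0 : ℝ)..1, G ((1 + t) / 2) = 2 * ∫ t in (1 / 2 : ℝ)..1, G t := by
        have := intervalIntegral.integral_comp_add_left (a := 0) (b := 1) (fun t => G (t / 2)) 1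
        rw [this]
        norm_num
      rw [hG', intervalIntegral.integral_add hl hr, h1, h2, ← mul_add,
        intervalIntegral.integral_add_adjacent_intervals]
      · refine hG.mono_set ?_
        rw [Set.uIcc_of_le (by norm_num), Set.uIcc_of_le (by norm_num)]
        exact Set.Icc_subset_Icc le_rfl (by norm_num)
      · refine hG.mono_set ?_
        rw [Set.uIcc_of_le (by norm_num), Set.uIcc_of_le (by norm_num)]
        exact Set.Icc_subset_Icc (by norm_num) le_rfl
    have hmain := ih G' (hl.add hr) (fun k => β (k + 1)) (fun k x hx x' hx' => by
      rw [hG', gridSum_gridSum_one, gridSum_gridSum_one]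
      exact hβ (k + 1) x hx x' hx') (m / 2) (by rw [pow_succ] at hm; omega)
    rw [hintegr] at hmain
    have h0 : ∀ x ∈ Set.Ico (0 : ℝ) 1, |G x - ∫ t in (0 : ℝ)..1, G t| ≤ β 0 := fun x hx =>
      abs_sub_integral_le hG (fun x hx x' hx' => by
        simpa [gridSum_zero] using hβ 0 x hx x' hx') hx
    have hβ0 : 0 ≤ β 0 := (abs_nonneg _).trans (h0 0 (by simp))
    rw [Finset.sum_range_succ']
    set I := ∫ t in (0 : ℝ)..1, G t
    rcases Nat.mod_two_eq_zero_or_one m with h | h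
    · obtain ⟨p, rfl⟩ : ∃ p, m = 2 * p := ⟨m / 2, by omega⟩
      rw [Nat.mul_div_cancel_left p two_pos] at hmain
      rw [sum_sobol_two_mul]
      push_cast
      calc _ = |∑ j ∈ Finset.range p, G' (sobol j) - p * (2 * I)| := by
            congr 1; ring
        _ ≤ _ := by linarith
    · obtain ⟨p, rfl⟩ : ∃ p, m = 2 * p + 1 := ⟨m / 2, by omega⟩
      rw [show (2 * p + 1) / 2 = p by omega] at hmain
      rw [Finset.sum_range_succ, sum_sobol_two_mul]
      push_cast
      calc _ = |(∑ j ∈ Finset.range p, G' (sobol j) - p * (2 * I)) + (G (sobol (2 * p)) - I)| := by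
            congr 1; ring
        _ ≤ _ := (abs_add_le _ _).trans (add_le_add hmain (h0 _ (sobol_mem_Ico _)))

theorem natLog_two_add_one_le {m : ℕ} (hm : 2 ≤ m) :
    ((Nat.log 2 m + 1 : ℕ) : ℝ) ≤ 3 * Real.log m := by
  have h2 : (0.6931471803 : ℝ) < Real.log 2 := Real.log_two_gt_d9
  have h1 : (Nat.log 2 m : ℝ) * Real.log 2 ≤ Real.log m := by
    rw [← Real.log_pow]
    refine Real.log_le_log (by positivity) ?_
    exact_mod_cast Nat.pow_log_le_self 2 (by omega)
  have h3 : Real.log 2 ≤ Real.log m := Real.log_le_log (by norm_num) (by exact_mod_cast hm)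
  have h4 : (0 : ℝ) ≤ Nat.log 2 m := by positivity
  push_cast
  nlinarith

/-- A function that is Lipschitz with respect to a monotone function of total increase `ℓ` has
grid sums of oscillation at most `L * ℓ`. -/
theorem abs_gridSum_sub_le_of_monotoneOn {G Q : ℝ → ℝ} {L α ℓ : ℝ} (hL : 0 ≤ L)
    (hQ : MonotoneOn Q (Set.Icc 0 1)) (hα : α ≤ Q 0) (hℓ : Q 1 ≤ α + ℓ)
    (hG : ∀ u ∈ Set.Icc (0 : ℝ) 1, ∀ u' ∈ Set.Icc (0 : ℝ) 1, |G u - G u'| ≤ L * |Q u - Q u'|)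
    (k : ℕ) {x x' : ℝ} (hx : x ∈ Set.Icc (0 : ℝ) 1) (hx' : x' ∈ Set.Icc (0 : ℝ) 1) :
    |gridSum k G x - gridSum k G x'| ≤ L * ℓ := by
  have hN : (0 : ℝ) < 2 ^ k := by positivity
  have hmem : ∀ l ∈ Finset.range (2 ^ k), ∀ y ∈ Set.Icc (0 : ℝ) 1,
      (l + y) / 2 ^ k ∈ Set.Icc (0 : ℝ) 1 := fun l hl y hy => by
    have h1 : ((l : ℝ) + 1) ≤ 2 ^ k := by exact_mod_cast Finset.mem_range.1 hl
    have h0 : (0 : ℝ) ≤ l := by positivity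
    exact ⟨by have := hy.1; positivity, by rw [div_le_one hN]; linarith [hy.2]⟩
  have hcell : ∀ l ∈ Finset.range (2 ^ k), |G ((l + x) / 2 ^ k) - G ((l + x') / 2 ^ k)| ≤
      L * (Q (((l + 1 : ℕ) : ℝ) / 2 ^ k) - Q ((l : ℝ) / 2 ^ k)) := fun l hl => by
    refine (hG _ (hmem l hl x hx) _ (hmem l hl x' hx')).trans
      (mul_le_mul_of_nonneg_left ?_ hL)
    have m0 := hmem l hl 0 (by simp)
    have m1 := hmem l hl 1 (by simp)
    rw [add_zero] at m0
    have key : ∀ y ∈ Set.Icc (0 : ℝ) 1,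
        Q ((l : ℝ) / 2 ^ k) ≤ Q ((l + y) / 2 ^ k) ∧ Q ((l + y) / 2 ^ k) ≤ Q ((l + 1) / 2 ^ k) :=
      fun y hy => ⟨hQ m0 (hmem l hl y hy) (by gcongr; linarith [hy.1]),
        hQ (hmem l hl y hy) m1 (by gcongr; exact hy.2)⟩
    push_cast
    rw [abs_le]
    constructor <;> linarith [(key x hx).1, (key x hx).2, (key x' hx').1, (key x' hx').2]
  unfold gridSum
  rw [← Finset.sum_sub_distrib]
  refine (Finset.abs_sum_le_sum_abs _ _).trans ((Finset.sum_le_sum hcell).trans ?_)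
  rw [← Finset.mul_sum, Finset.sum_range_sub (fun l : ℕ => Q ((l : ℝ) / 2 ^ k))]
  refine mul_le_mul_of_nonneg_left ?_ hL
  push_cast
  rw [div_self hN.ne', zero_div]
  linarith

end VanDerCorput

section PiecewiseSmooth

/-- The deviation of the increment of `G` between two points of `[t, t + h]` from the increment of
the chord of `G` over that interval. -/
def cellDefect (G : ℝ → ℝ) (t h x x' : ℝ) : ℝ :=
  G (t + h * x) - G (t + h * x') - (x - x') * (G (t + h) - G t)

theorem abs_cellDefect_le {G : ℝ → ℝ} {t h x x' p ε : ℝ} (hh : 0 ≤ h) (hε : 0 ≤ ε)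
    (hx : x ∈ Set.Icc (0 : ℝ) 1) (hx' : x' ∈ Set.Icc (0 : ℝ) 1)
    (hG : ∀ s ∈ Set.Icc t (t + h), ∀ s' ∈ Set.Icc t (t + h),
      |G s - G s' - p * (s - s')| ≤ ε * |s - s'|) :
    |cellDefect G t h x x'| ≤ 2 * ε * h := by
  have hmem : ∀ y ∈ Set.Icc (0 : ℝ) 1, t + h * y ∈ Set.Icc t (t + h) := fun y hy =>
    ⟨by nlinarith [hy.1], by nlinarith [hy.2]⟩
  have hd : |x - x'| ≤ 1 := by rw [abs_le]; constructor <;> linarith [hx.1, hx.2, hx'.1, hx'.2]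
  have h1 := hG _ (hmem x hx) _ (hmem x' hx')
  have h2 := hG (t + h) ⟨by linarith, le_rfl⟩ t ⟨le_rfl, by linarith⟩
  rw [show t + h * x - (t + h * x') = h * (x - x') by ring, abs_mul, abs_of_nonneg hh] at h1
  rw [show t + h - t = h by ring, abs_of_nonneg hh] at h2
  have e : cellDefect G t h x x' = (G (t + h * x) - G (t + h * x') - p * (h * (x - x'))) -
      (x - x') * (G (t + h) - G t - p * h) := by unfold cellDefect; ring
  rw [e]
  refine (abs_sub _ _).trans ?_
  rw [abs_mul]
  have h3 : ε * (h * |x - x'|) ≤ ε * h := by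
    refine mul_le_mul_of_nonneg_left ?_ hε
    nlinarith
  have h4 : |x - x'| * |G (t + h) - G t - p * h| ≤ 1 * (ε * h) :=
    mul_le_mul hd h2 (abs_nonneg _) zero_le_one
  linarith

theorem abs_cellDefect_le_of_lipschitz {G : ℝ → ℝ} {t h x x' L : ℝ} (hh : 0 ≤ h) (hL : 0 ≤ L)
    (hx : x ∈ Set.Icc (0 : ℝ) 1) (hx' : x' ∈ Set.Icc (0 : ℝ) 1)
    (hG : ∀ s ∈ Set.Icc t (t + h), ∀ s' ∈ Set.Icc t (t + h), |G s - G s'| ≤ L * |s - s'|) :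
    |cellDefect G t h x x'| ≤ 2 * L * h :=
  abs_cellDefect_le (p := 0) hh hL hx hx' (by simpa using hG)

theorem abs_max_zero_sub_le (a b : ℝ) : |max a 0 - max b 0| ≤ |a - b| := by
  simpa using abs_max_sub_max_le_abs a b 0

/-- The positive part of a function with slopes in `[q - ε, q + ε]`, `q > 2ε`: only the cell that
contains the zero has a large defect. -/
theorem sum_abs_cellDefect_posPart_le_of_increasing {b : ℝ → ℝ} {a h x x' q ε L : ℝ} {J : ℕ}
    (hh : 0 < h) (hε : 0 ≤ ε) (hL : 0 ≤ L) (hq : ε < q)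
    (hx : x ∈ Set.Icc (0 : ℝ) 1) (hx' : x' ∈ Set.Icc (0 : ℝ) 1)
    (hb : ∀ s ∈ Set.Icc a (a + J * h), ∀ s' ∈ Set.Icc a (a + J * h),
      |b s - b s' - q * (s - s')| ≤ ε * |s - s'|)
    (hbL : ∀ s ∈ Set.Icc a (a + J * h), ∀ s' ∈ Set.Icc a (a + J * h),
      |b s - b s'| ≤ L * |s - s'|) :
    ∑ j ∈ Finset.range J, |cellDefect (fun s => max (b s) 0) (a + j * h) h x x'| ≤
      2 * ε * h * J + 2 * L * h := by
  have hmono : ∀ s ∈ Set.Icc a (a + J * h), ∀ s' ∈ Set.Icc a (a + J * h), s' ≤ s → b s' ≤ b s :=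
    fun s hs s' hs' hle => by
      have := (abs_le.1 (hb s hs s' hs')).1
      rw [abs_of_nonneg (by linarith)] at this
      nlinarith
  have hsub : ∀ j ∈ Finset.range J, Set.Icc (a + j * h) (a + j * h + h) ⊆
      Set.Icc a (a + J * h) := fun j hj => by
    have h1 : ((j : ℝ) + 1) ≤ J := by exact_mod_cast Finset.mem_range.1 hj
    exact Set.Icc_subset_Icc (by have : (0 : ℝ) ≤ j * h := by positivity
                                 linarith) (by nlinarith)
  classical
  have hcell : ∀ j ∈ Finset.range J, |cellDefect (fun s => max (b s) 0) (a + j * h) h x x'| ≤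
      2 * ε * h + if b (a + j * h) < 0 ∧ 0 < b (a + j * h + h) then 2 * L * h else 0 :=
    fun j hj => by
      have hl : a + j * h ∈ Set.Icc (a + j * h) (a + j * h + h) := ⟨le_rfl, by linarith⟩
      have hr : a + j * h + h ∈ Set.Icc (a + j * h) (a + j * h + h) := ⟨by linarith, le_rfl⟩
      split_ifs with hs
      · have := abs_cellDefect_le_of_lipschitz (G := fun s => max (b s) 0) hh.le hL hx hx'
          fun s hs s' hs' => (abs_max_zero_sub_le _ _).trans (hbL s (hsub j hj hs) s' (hsub j hj hs'))
        have : 0 ≤ 2 * ε * h := by positivity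
        linarith
      · rw [add_zero]
        rcases le_or_gt 0 (b (a + j * h)) with h0 | h0
        · refine abs_cellDefect_le (p := q) hh.le hε hx hx' fun s hs s' hs' => ?_
          have e1 := h0.trans (hmono s (hsub j hj hs) _ (hsub j hj hl) hs.1)
          have e2 := h0.trans (hmono s' (hsub j hj hs') _ (hsub j hj hl) hs'.1)
          simp only [max_eq_left e1, max_eq_left e2]
          exact hb s (hsub j hj hs) s' (hsub j hj hs')
        · have h1 : b (a + j * h + h) ≤ 0 := not_lt.1 fun h1 => hs ⟨h0, h1⟩
          refine abs_cellDefect_le (p := 0) hh.le hε hx hx' fun s hs s' hs' => ?_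
          have e1 := (hmono _ (hsub j hj hr) s (hsub j hj hs) hs.2).trans h1
          have e2 := (hmono _ (hsub j hj hr) s' (hsub j hj hs') hs'.2).trans h1
          simp only [max_eq_right e1, max_eq_right e2]
          simpa using mul_nonneg hε (abs_nonneg (s - s'))
  refine (Finset.sum_le_sum hcell).trans ?_
  rw [Finset.sum_add_distrib, Finset.sum_const, Finset.card_range, nsmul_eq_mul,
    ← Finset.sum_filter, Finset.sum_const, nsmul_eq_mul, mul_comm (J : ℝ)]
  have hcard : ((Finset.range J).filter
      fun j : ℕ => b (a + j * h) < 0 ∧ 0 < b (a + j * h + h)).card ≤ 1 := by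
    have key : ∀ i ∈ Finset.range J, ∀ j ∈ Finset.range J, i < j →
        0 < b (a + i * h + h) → ¬ b (a + j * h) < 0 := fun i hi j hj hij hpos hneg => by
      have h1 : ((i : ℝ) + 1) ≤ j := by exact_mod_cast hij
      have := hmono (a + j * h) (hsub j hj ⟨le_rfl, by linarith⟩) (a + i * h + h)
        (hsub i hi ⟨by linarith, le_rfl⟩) (by nlinarith)
      linarith
    refine Finset.card_le_one.2 fun i hi j hj => ?_
    rw [Finset.mem_filter] at hi hj
    rcases lt_trichotomy i j with hij | hij | hij
    · exact absurd hj.2.1 (key i hi.1 j hj.1 hij hi.2.2)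
    · exact hij
    · exact absurd hi.2.1 (key j hj.1 i hi.1 hij hj.2.2)
  have hcard' : (((Finset.range J).filter
      fun j : ℕ => b (a + j * h) < 0 ∧ 0 < b (a + j * h + h)).card : ℝ) ≤ 1 := by
    exact_mod_cast hcard
  have : 0 ≤ 2 * L * h := by positivity
  nlinarith

theorem sum_abs_cellDefect_posPart_le {b : ℝ → ℝ} {a h x x' q ε L : ℝ} {J : ℕ}
    (hh : 0 < h) (hε : 0 ≤ ε) (hL : 0 ≤ L)
    (hx : x ∈ Set.Icc (0 : ℝ) 1) (hx' : x' ∈ Set.Icc (0 : ℝ) 1)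
    (hb : ∀ s ∈ Set.Icc a (a + J * h), ∀ s' ∈ Set.Icc a (a + J * h),
      |b s - b s' - q * (s - s')| ≤ ε * |s - s'|)
    (hbL : ∀ s ∈ Set.Icc a (a + J * h), ∀ s' ∈ Set.Icc a (a + J * h),
      |b s - b s'| ≤ L * |s - s'|) :
    ∑ j ∈ Finset.range J, |cellDefect (fun s => max (b s) 0) (a + j * h) h x x'| ≤
      4 * ε * h * J + 2 * L * h := by
  have hsub : ∀ j ∈ Finset.range J, Set.Icc (a + j * h) (a + j * h + h) ⊆
      Set.Icc a (a + J * h) := fun j hj => by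
    have h1 : ((j : ℝ) + 1) ≤ J := by exact_mod_cast Finset.mem_range.1 hj
    exact Set.Icc_subset_Icc (by have : (0 : ℝ) ≤ j * h := by positivity
                                 linarith) (by nlinarith)
  have hnn : 0 ≤ 2 * ε * h * J := by positivity
  have hnn' : 0 ≤ 2 * L * h := by positivity
  rcases lt_or_ge ε q with hq | hq
  · have := sum_abs_cellDefect_posPart_le_of_increasing hh hε hL hq hx hx' hb hbL
    linarith
  rcases lt_or_ge ε (-q) with hq' | hq'
  · have h1 := sum_abs_cellDefect_posPart_le_of_increasing (b := fun s => - b s) hh hε hL hq' hx hx'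
      (fun s hs s' hs' => by
        rw [← abs_neg]; refine le_trans (le_of_eq ?_) (hb s hs s' hs'); congr 1; ring)
      (fun s hs s' hs' => by
        rw [← abs_neg]; refine le_trans (le_of_eq ?_) (hbL s hs s' hs'); congr 1; ring)
    have h2 : ∀ j ∈ Finset.range J, |cellDefect (fun s => max (b s) 0) (a + j * h) h x x'| ≤
        2 * ε * h + |cellDefect (fun s => max (- b s) 0) (a + j * h) h x x'| := fun j hj => by
      have e : cellDefect (fun s => max (b s) 0) (a + j * h) h x x' =
          cellDefect b (a + j * h) h x x' +
            cellDefect (fun s => max (- b s) 0) (a + j * h) h x x' := by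
        have hp : ∀ s, max (b s) 0 = b s + max (- b s) 0 := fun s => by
          rw [← max_add_add_left]; simp [max_comm]
        unfold cellDefect
        simp only [hp]
        ring
      rw [e]
      exact (abs_add_le _ _).trans (add_le_add_left (abs_cellDefect_le hh.le hε hx hx'
        fun s hs s' hs' => hb s (hsub j hj hs) s' (hsub j hj hs')) _)
    refine (Finset.sum_le_sum h2).trans ?_
    rw [Finset.sum_add_distrib, Finset.sum_const, Finset.card_range, nsmul_eq_mul,
      mul_comm (J : ℝ)]
    linarith
  · have h2 : ∀ j ∈ Finset.range J, |cellDefect (fun s => max (b s) 0) (a + j * h) h x x'| ≤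
        2 * (2 * ε) * h := fun j hj => by
      refine abs_cellDefect_le_of_lipschitz hh.le (by positivity) hx hx' fun s hs s' hs' => ?_
      refine (abs_max_zero_sub_le _ _).trans ?_
      have h3 := hb s (hsub j hj hs) s' (hsub j hj hs')
      have h4 : |q * (s - s')| ≤ ε * |s - s'| := by
        rw [abs_mul]
        exact mul_le_mul_of_nonneg_right (abs_le.2 ⟨by linarith, hq⟩) (abs_nonneg _)
      have h5 := abs_add_le (b s - b s' - q * (s - s')) (q * (s - s'))
      rw [sub_add_cancel] at h5
      linarith
    refine (Finset.sum_le_sum h2).trans ?_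
    rw [Finset.sum_const, Finset.card_range, nsmul_eq_mul]
    nlinarith

theorem sum_range_mul_eq (f : ℕ → ℝ) (K J : ℕ) :
    ∑ l ∈ Finset.range (K * J), f l =
      ∑ i ∈ Finset.range K, ∑ j ∈ Finset.range J, f (i * J + j) := by
  induction K with
  | zero => simp
  | succ K ih => rw [Nat.succ_mul, Finset.sum_range_add, ih, Finset.sum_range_succ]

/-- If `a` and `b` are nearly affine on each of `2 ^ k₀` intervals, then the grid sums of
`G = a + b⁺` have an oscillation that is controlled by `|G 1 - G 0|` alone, up to small terms. -/
theorem abs_gridSum_sub_le_of_nearly_affine {a b : ℝ → ℝ} {ε L : ℝ} {k₀ k : ℕ} (hε : 0 ≤ ε)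
    (hL : 0 ≤ L) (hk : k₀ ≤ k)
    (hab : ∀ i : ℕ, i < 2 ^ k₀ → ∃ p q : ℝ,
      ∀ s ∈ Set.Icc ((i : ℝ) / 2 ^ k₀) (((i : ℝ) + 1) / 2 ^ k₀),
      ∀ s' ∈ Set.Icc ((i : ℝ) / 2 ^ k₀) (((i : ℝ) + 1) / 2 ^ k₀),
        |a s - a s' - p * (s - s')| ≤ ε * |s - s'| ∧ |b s - b s' - q * (s - s')| ≤ ε * |s - s'|)
    (hbL : ∀ s ∈ Set.Icc (0 : ℝ) 1, ∀ s' ∈ Set.Icc (0 : ℝ) 1, |b s - b s'| ≤ L * |s - s'|)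
    {x x' : ℝ} (hx : x ∈ Set.Icc (0 : ℝ) 1) (hx' : x' ∈ Set.Icc (0 : ℝ) 1) :
    |gridSum k (fun s => a s + max (b s) 0) x - gridSum k (fun s => a s + max (b s) 0) x'| ≤
      |(a 1 + max (b 1) 0) - (a 0 + max (b 0) 0)| + 6 * ε + 2 * L * (2 ^ k₀ / 2 ^ k) := by
  set G : ℝ → ℝ := fun s => a s + max (b s) 0 with hGdef
  obtain ⟨r, rfl⟩ : ∃ r, k = k₀ + r := ⟨k - k₀, by omega⟩
  set h : ℝ := 1 / 2 ^ (k₀ + r) with hhdef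
  have hh : 0 < h := by positivity
  have hd : |x - x'| ≤ 1 := by rw [abs_le]; constructor <;> linarith [hx.1, hx.2, hx'.1, hx'.2]
  have htel : gridSum (k₀ + r) G x - gridSum (k₀ + r) G x' =
      ∑ l ∈ Finset.range (2 ^ (k₀ + r)), cellDefect G (l * h) h x x' +
        (x - x') * (G 1 - G 0) := by
    have h1 : ∑ l ∈ Finset.range (2 ^ (k₀ + r)), (G (((l + 1 : ℕ) : ℝ) * h) - G ((l : ℝ) * h)) =
        G 1 - G 0 := by
      rw [Finset.sum_range_sub (fun l : ℕ => G ((l : ℝ) * h))]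
      push_cast
      rw [hhdef, mul_one_div_cancel (by positivity), zero_mul]
    rw [← h1, Finset.mul_sum, ← Finset.sum_add_distrib]
    unfold gridSum
    rw [← Finset.sum_sub_distrib]
    refine Finset.sum_congr rfl fun l _ => ?_
    unfold cellDefect
    rw [show ((l : ℝ) + x) / 2 ^ (k₀ + r) = l * h + h * x by rw [hhdef]; ring,
      show ((l : ℝ) + x') / 2 ^ (k₀ + r) = l * h + h * x' by rw [hhdef]; ring]
    push_cast
    rw [show ((l : ℝ) + 1) * h = l * h + h by ring]
    ring
  have hJ : ((2 ^ r : ℕ) : ℝ) * h = 1 / 2 ^ k₀ := by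
    rw [hhdef, pow_add]; push_cast; field_simp
  have hcoarse : ∀ i ∈ Finset.range (2 ^ k₀),
      ∑ j ∈ Finset.range (2 ^ r), |cellDefect G (((i * 2 ^ r + j : ℕ) : ℝ) * h) h x x'| ≤
        6 * ε * (1 / 2 ^ k₀) + 2 * L * h := fun i hi => by
    obtain ⟨p, q, hpq⟩ := hab i (Finset.mem_range.1 hi)
    set α : ℝ := (i : ℝ) / 2 ^ k₀ with hα
    have hα' : ((i : ℝ) + 1) / 2 ^ k₀ = α + ((2 ^ r : ℕ) : ℝ) * h := by rw [hJ, hα]; ring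
    rw [hα'] at hpq
    have hpt : ∀ j : ℕ, ((i * 2 ^ r + j : ℕ) : ℝ) * h = α + j * h := fun j => by
      have e : ((2 : ℝ) ^ r) * h = 1 / 2 ^ k₀ := by exact_mod_cast hJ
      push_cast
      rw [add_mul, mul_assoc, e, hα]; ring
    have hi1 : ((i : ℝ) + 1) / 2 ^ k₀ ≤ 1 := by
      rw [div_le_one (by positivity)]; exact_mod_cast Finset.mem_range.1 hi
    have hsubI : Set.Icc α (α + ((2 ^ r : ℕ) : ℝ) * h) ⊆ Set.Icc (0 : ℝ) 1 :=
      Set.Icc_subset_Icc (by positivity) (by rw [← hα']; exact hi1)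
    have hsub : ∀ j ∈ Finset.range (2 ^ r), Set.Icc (α + j * h) (α + j * h + h) ⊆
        Set.Icc α (α + ((2 ^ r : ℕ) : ℝ) * h) := fun j hj => by
      have h1 : ((j : ℝ) + 1) ≤ (2 ^ r : ℕ) := by exact_mod_cast Finset.mem_range.1 hj
      exact Set.Icc_subset_Icc (by have : (0 : ℝ) ≤ j * h := by positivity
                                   linarith) (by nlinarith)
    have hA : ∀ j ∈ Finset.range (2 ^ r), |cellDefect a (α + j * h) h x x'| ≤ 2 * ε * h :=
      fun j hj => abs_cellDefect_le hh.le hε hx hx'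
        fun s hs s' hs' => (hpq s (hsub j hj hs) s' (hsub j hj hs')).1
    have hB := sum_abs_cellDefect_posPart_le hh hε hL hx hx'
      (fun s hs s' hs' => (hpq s hs s' hs').2)
      (fun s hs s' hs' => hbL s (hsubI hs) s' (hsubI hs'))
    have hsplit : ∀ j ∈ Finset.range (2 ^ r),
        |cellDefect G (((i * 2 ^ r + j : ℕ) : ℝ) * h) h x x'| ≤
          2 * ε * h + |cellDefect (fun s => max (b s) 0) (α + j * h) h x x'| := fun j hj => by
      rw [hpt]
      have e : cellDefect G (α + j * h) h x x' = cellDefect a (α + j * h) h x x' +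
          cellDefect (fun s => max (b s) 0) (α + j * h) h x x' := by
        unfold cellDefect; simp only [hGdef]; ring
      rw [e]
      exact (abs_add_le _ _).trans (add_le_add_left (hA j hj) _)
    refine (Finset.sum_le_sum hsplit).trans ?_
    rw [Finset.sum_add_distrib, Finset.sum_const, Finset.card_range, nsmul_eq_mul]
    calc _ ≤ ((2 ^ r : ℕ) : ℝ) * (2 * ε * h) + (4 * ε * h * (2 ^ r : ℕ) + 2 * L * h) :=
          add_le_add_right hB _
      _ = 6 * ε * (((2 ^ r : ℕ) : ℝ) * h) + 2 * L * h := by ring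
      _ = _ := by rw [hJ]
  rw [htel]
  refine (abs_add_le _ _).trans ?_
  have h1 : |∑ l ∈ Finset.range (2 ^ (k₀ + r)), cellDefect G (l * h) h x x'| ≤
      6 * ε + 2 * L * (2 ^ k₀ / 2 ^ (k₀ + r)) := by
    refine (Finset.abs_sum_le_sum_abs _ _).trans ?_
    rw [pow_add, sum_range_mul_eq]
    refine (Finset.sum_le_sum hcoarse).trans (le_of_eq ?_)
    rw [Finset.sum_const, Finset.card_range, nsmul_eq_mul, hhdef]
    push_cast
    field_simp
  have h2 : |(x - x') * (G 1 - G 0)| ≤ |G 1 - G 0| := by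
    rw [abs_mul]; exact mul_le_of_le_one_left (abs_nonneg _) hd
  linarith

end PiecewiseSmooth

section Quantile

variable {τ : Task} (μ : Measure τ.Hyper) [IsProbabilityMeasure μ]

theorem measureReal_le_eq_cdf (t : ℝ) :
    μ.real {s : τ.Hyper | (s : ℝ) ≤ t} = ProbabilityTheory.cdf (μ.map Subtype.val) t := by
  have : IsProbabilityMeasure (μ.map (Subtype.val : τ.Hyper → ℝ)) :=
    Measure.isProbabilityMeasure_map measurable_subtype_coe.aemeasurable
  rw [ProbabilityTheory.cdf_eq_real, map_measureReal_apply measurable_subtype_coe measurableSet_Iic]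
  rfl

theorem coe_quantile {u : ℝ} (hu : u ≤ 1) : (quantile τ μ u : ℝ) =
    sInf {t : ℝ | τ.lo ≤ t ∧ u ≤ μ.real {s : τ.Hyper | (s : ℝ) ≤ t}} := by
  have hhi : τ.hi ∈ {t : ℝ | τ.lo ≤ t ∧ u ≤ μ.real {s : τ.Hyper | (s : ℝ) ≤ t}} := by
    refine ⟨τ.lo_le_hi, ?_⟩
    have : {s : τ.Hyper | (s : ℝ) ≤ τ.hi} = Set.univ := Set.eq_univ_of_forall fun s => s.2.2
    simpa [this] using hu
  unfold quantile
  rw [Set.projIcc_of_mem]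
  exact ⟨le_csInf ⟨_, hhi⟩ fun t ht => ht.1, csInf_le ⟨τ.lo, fun t ht => ht.1⟩ hhi⟩

theorem quantile_le_iff {u : ℝ} (hu : u ≤ 1) (t : τ.Hyper) :
    quantile τ μ u ≤ t ↔ u ≤ μ.real {s : τ.Hyper | (s : ℝ) ≤ t} := by
  rw [← Subtype.coe_le_coe, coe_quantile μ hu]
  constructor
  · intro h
    have hcont := (ProbabilityTheory.cdf (μ.map (Subtype.val : τ.Hyper → ℝ))).right_continuous t
    rw [measureReal_le_eq_cdf]
    refine ge_of_tendsto (hcont.mono Set.Ioi_subset_Ici_self) ?_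
    filter_upwards [self_mem_nhdsWithin] with t' ht'
    have hne : {t : ℝ | τ.lo ≤ t ∧ u ≤ μ.real {s : τ.Hyper | (s : ℝ) ≤ t}}.Nonempty := by
      refine ⟨τ.hi, τ.lo_le_hi, ?_⟩
      have : {s : τ.Hyper | (s : ℝ) ≤ τ.hi} = Set.univ := Set.eq_univ_of_forall fun s => s.2.2
      simpa [this] using hu
    obtain ⟨r, hr, hrt⟩ := exists_lt_of_csInf_lt hne (h.trans_lt ht')
    refine hr.2.trans ?_
    rw [measureReal_le_eq_cdf]
    exact ProbabilityTheory.monotone_cdf _ hrt.le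
  · exact fun h => csInf_le ⟨τ.lo, fun t ht => ht.1⟩ ⟨t.2.1, h⟩

theorem quantile_monotoneOn : MonotoneOn (quantile τ μ) (Set.Iic 1) := fun u hu u' hu' h => by
  rw [quantile_le_iff μ hu]
  exact h.trans ((quantile_le_iff μ hu' _).1 le_rfl)

theorem aemeasurable_quantile :
    AEMeasurable (quantile τ μ) (volume.restrict (Set.Ioc (0 : ℝ) 1)) :=
  aemeasurable_restrict_of_monotoneOn measurableSet_Ioc
    ((quantile_monotoneOn μ).mono fun _ hu => hu.2)

theorem map_quantile : (volume.restrict (Set.Ioc (0 : ℝ) 1)).map (quantile τ μ) = μ := by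
  have : IsProbabilityMeasure (volume.restrict (Set.Ioc (0 : ℝ) 1)) := ⟨by simp⟩
  have : IsProbabilityMeasure ((volume.restrict (Set.Ioc (0 : ℝ) 1)).map (quantile τ μ)) :=
    Measure.isProbabilityMeasure_map (aemeasurable_quantile μ)
  refine Measure.ext_of_Iic _ _ fun t => ?_
  rw [Measure.map_apply_of_aemeasurable (aemeasurable_quantile μ) measurableSet_Iic,
    Measure.restrict_apply' measurableSet_Ioc]
  have h1 : quantile τ μ ⁻¹' Set.Iic t ∩ Set.Ioc (0 : ℝ) 1 = Set.Ioc 0 (μ.real (Set.Iic t)) := by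
    ext u
    simp only [Set.mem_inter_iff, Set.mem_preimage, Set.mem_Iic, Set.mem_Ioc]
    constructor
    · rintro ⟨h, h0, h1⟩
      exact ⟨h0, (quantile_le_iff μ h1 t).1 h⟩
    · rintro ⟨h0, h1⟩
      have hu : u ≤ 1 := h1.trans measureReal_le_one
      exact ⟨(quantile_le_iff μ hu t).2 h1, h0, hu⟩
  rw [h1, Real.volume_Ioc, sub_zero, ofReal_measureReal]

theorem integral_comp_quantile {g : τ.Hyper → ℝ} (hg : Continuous g) :
    ∫ θ, g θ ∂μ = ∫ u in (0 : ℝ)..1, g (quantile τ μ u) := by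
  rw [intervalIntegral.integral_of_le zero_le_one]
  conv_lhs => rw [← map_quantile μ]
  exact integral_map (aemeasurable_quantile μ) hg.aestronglyMeasurable

theorem intervalIntegrable_comp_quantile {g : τ.Hyper → ℝ} (hg : Continuous g) :
    IntervalIntegrable (fun u => g (quantile τ μ u)) volume 0 1 := by
  rw [intervalIntegrable_iff_integrableOn_Ioc_of_le zero_le_one]
  have h1 : Integrable g μ := by
    obtain ⟨C, hC⟩ := isCompact_univ.exists_bound_of_continuousOn hg.continuousOn
    exact Integrable.of_bound hg.aestronglyMeasurable C (Filter.Eventually.of_forall fun x => hC x trivial)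
  rw [← map_quantile μ] at h1
  exact (integrable_map_measure hg.aestronglyMeasurable (aemeasurable_quantile μ)).1 h1

theorem Task.lo_lt_hi (τ : Task) : τ.lo < τ.hi := by
  cases τ <;> norm_num [Task.lo, Task.hi]

theorem uniform_le {t : ℝ} (ht : t ∈ Set.Icc τ.lo τ.hi) :
    τ.uniform {s : τ.Hyper | (s : ℝ) ≤ t} = ENNReal.ofReal ((t - τ.lo) / (τ.hi - τ.lo)) := by
  have hpos : 0 < τ.hi - τ.lo := sub_pos.2 τ.lo_lt_hi
  have h1 : (Subtype.val : τ.Hyper → ℝ) '' {s : τ.Hyper | (s : ℝ) ≤ t} = Set.Icc τ.lo t := by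
    ext r
    constructor
    · rintro ⟨s, hs, rfl⟩
      exact ⟨s.2.1, hs⟩
    · rintro ⟨h0, h1⟩
      exact ⟨⟨r, h0, h1.trans ht.2⟩, h1, rfl⟩
  rw [Task.uniform, Measure.smul_apply,
    (MeasurableEmbedding.subtype_coe measurableSet_Icc).comap_apply, h1, Real.volume_Icc,
    smul_eq_mul, mul_comm, ← div_eq_mul_inv, ENNReal.ofReal_div_of_pos hpos]

theorem isProbabilityMeasure_uniform (τ : Task) : IsProbabilityMeasure τ.uniform := by
  have hpos : 0 < τ.hi - τ.lo := sub_pos.2 τ.lo_lt_hi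
  refine ⟨?_⟩
  have h := uniform_le (τ := τ) (t := τ.hi) ⟨τ.lo_le_hi, le_rfl⟩
  have h1 : {s : τ.Hyper | (s : ℝ) ≤ τ.hi} = Set.univ := Set.eq_univ_of_forall fun s => s.2.2
  rw [h1, div_self hpos.ne', ENNReal.ofReal_one] at h
  exact h

theorem coe_quantile_uniform (τ : Task) {u : ℝ} (hu : u ∈ Set.Icc (0 : ℝ) 1) :
    (quantile τ τ.uniform u : ℝ) = τ.lo + (τ.hi - τ.lo) * u := by
  have := isProbabilityMeasure_uniform τ
  have hpos : 0 < τ.hi - τ.lo := sub_pos.2 τ.lo_lt_hi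
  have hF : ∀ t : τ.Hyper,
      τ.uniform.real {s : τ.Hyper | (s : ℝ) ≤ t} = (t - τ.lo) / (τ.hi - τ.lo) := fun t => by
    rw [Measure.real, uniform_le t.2, ENNReal.toReal_ofReal]
    exact div_nonneg (sub_nonneg.2 t.2.1) hpos.le
  have hmem : τ.lo + (τ.hi - τ.lo) * u ∈ Set.Icc τ.lo τ.hi :=
    ⟨by nlinarith [hu.1], by nlinarith [hu.2]⟩
  refine le_antisymm ?_ ?_
  · have h := (quantile_le_iff τ.uniform hu.2 ⟨_, hmem⟩).2 (by
      rw [hF]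
      simp [mul_div_cancel_left₀ _ hpos.ne'])
    exact h
  · have h := (quantile_le_iff τ.uniform hu.2 (quantile τ τ.uniform u)).1 le_rfl
    rw [hF, le_div_iff₀ hpos] at h
    linarith

end Quantile

section Rademacher

/-- The sign `±1` encoded by a Boolean. -/
def boolSign (b : Bool) : ℝ := if b then 1 else -1

@[simp] theorem boolSign_true : boolSign true = 1 := rfl

@[simp] theorem boolSign_false : boolSign false = -1 := rfl

theorem boolSign_not (b : Bool) : boolSign (!b) = -boolSign b := by cases b <;> simp

theorem abs_boolSign (b : Bool) : |boolSign b| = 1 := by cases b <;> simp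

theorem sum_signs_succ {M : Type*} [AddCommMonoid M] {n : ℕ} (F : (Fin (n + 1) → Bool) → M) :
    ∑ ε, F ε = ∑ ε : Fin n → Bool, (F (Fin.cons true ε) + F (Fin.cons false ε)) := by
  rw [← (Fin.consEquiv fun _ => Bool).sum_comp, Fintype.sum_prod_type, Fintype.sum_bool,
    ← Finset.sum_add_distrib]
  rfl

theorem iSup_contraction {ι : Type*} [Nonempty ι] {u a : ι → ℝ} {φ : ℝ → ℝ}
    (hu : ∃ C, ∀ t, |u t| ≤ C) (ha : ∃ C, ∀ t, |a t| ≤ C) (hφ : ∀ x y, |φ x - φ y| ≤ |x - y|) :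
    (⨆ t, (u t + φ (a t))) + (⨆ t, (u t - φ (a t))) ≤ (⨆ t, (u t + a t)) + ⨆ t, (u t - a t) := by
  obtain ⟨C, hC⟩ := hu
  obtain ⟨A, hA⟩ := ha
  have b1 : BddAbove (Set.range fun t => u t + a t) := ⟨C + A, by
    rintro _ ⟨t, rfl⟩
    exact add_le_add (le_of_abs_le (hC t)) (le_of_abs_le (hA t))⟩
  have b2 : BddAbove (Set.range fun t => u t - a t) := ⟨C + A, by
    rintro _ ⟨t, rfl⟩
    have := neg_le_of_abs_le (hA t)
    have := le_of_abs_le (hC t)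
    simp only; linarith⟩
  have key : ∀ t t', (u t + φ (a t)) + (u t' - φ (a t')) ≤
      (⨆ t, (u t + a t)) + ⨆ t, (u t - a t) := fun t t' => by
    have h1 := le_of_abs_le (hφ (a t) (a t'))
    have e1 := le_ciSup b1 t
    have e2 := le_ciSup b1 t'
    have e3 := le_ciSup b2 t
    have e4 := le_ciSup b2 t'
    rcases abs_cases (a t - a t') with h | h <;> linarith
  rw [← le_sub_iff_add_le]
  refine ciSup_le fun t => ?_
  rw [le_sub_iff_add_le, add_comm, ← le_sub_iff_add_le]
  refine ciSup_le fun t' => ?_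
  rw [le_sub_iff_add_le, add_comm]
  exact key t t'

theorem bounded_sum_signs {ι : Type*} {n : ℕ} {u : ι → ℝ} {a : Fin n → ι → ℝ}
    (hu : ∃ C, ∀ t, |u t| ≤ C) (ha : ∀ i, ∃ C, ∀ t, |a i t| ≤ C) (ε : Fin n → Bool) :
    ∃ C, ∀ t, |u t + ∑ i, boolSign (ε i) * a i t| ≤ C := by
  obtain ⟨C, hC⟩ := hu
  choose A hA using ha
  refine ⟨C + ∑ i, A i, fun t => (abs_add_le _ _).trans (add_le_add (hC t) ?_)⟩
  refine (Finset.abs_sum_le_sum_abs _ _).trans (Finset.sum_le_sum fun i _ => ?_)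
  rw [abs_mul, abs_boolSign, one_mul]
  exact hA i t

/-- The contraction principle for Rademacher averages. -/
theorem sum_signs_iSup_contraction {ι : Type*} [Nonempty ι] (n : ℕ) : ∀ (u : ι → ℝ)
    (a : Fin n → ι → ℝ) (φ : Fin n → ℝ → ℝ), (∃ C, ∀ t, |u t| ≤ C) →
    (∀ i, ∃ C, ∀ t, |a i t| ≤ C) → (∀ i x y, |φ i x - φ i y| ≤ |x - y|) →
    ∑ ε : Fin n → Bool, (⨆ t, (u t + ∑ i, boolSign (ε i) * φ i (a i t))) ≤
      ∑ ε : Fin n → Bool, ⨆ t, (u t + ∑ i, boolSign (ε i) * a i t) := by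
  induction n with
  | zero => intro u a φ _ _ _; simp
  | succ n ih =>
    intro u a φ hu ha hφ
    have hφa : ∀ i, ∃ C, ∀ t, |φ i (a i t)| ≤ C := fun i => by
      obtain ⟨C, hC⟩ := ha i
      refine ⟨|φ i 0| + C, fun t => ?_⟩
      have h1 := hφ i (a i t) 0
      rw [sub_zero] at h1
      have h2 := abs_add_le (φ i 0) (φ i (a i t) - φ i 0)
      rw [add_sub_cancel] at h2
      linarith [hC t]
    rw [sum_signs_succ, sum_signs_succ]
    simp only [Fin.sum_univ_succ, Fin.cons_zero, Fin.cons_succ, boolSign_true, boolSign_false,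
      one_mul, neg_one_mul]
    have step1 : ∀ ε : Fin n → Bool,
        (⨆ t, (u t + (φ 0 (a 0 t) + ∑ i : Fin n, boolSign (ε i) * φ i.succ (a i.succ t)))) +
          (⨆ t, (u t + (-φ 0 (a 0 t) + ∑ i : Fin n, boolSign (ε i) * φ i.succ (a i.succ t)))) ≤
        (⨆ t, ((u t + a 0 t) + ∑ i : Fin n, boolSign (ε i) * φ i.succ (a i.succ t))) +
          ⨆ t, ((u t - a 0 t) + ∑ i : Fin n, boolSign (ε i) * φ i.succ (a i.succ t)) := fun ε => by
      have := iSup_contraction (φ := φ 0)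
        (bounded_sum_signs hu (fun i : Fin n => hφa i.succ) ε) (ha 0) (hφ 0)
      convert this using 4 <;> ring
    refine (Finset.sum_le_sum fun ε _ => step1 ε).trans ?_
    rw [Finset.sum_add_distrib]
    have hup : ∃ C, ∀ t, |u t + a 0 t| ≤ C := by
      obtain ⟨C, hC⟩ := hu
      obtain ⟨A, hA⟩ := ha 0
      exact ⟨C + A, fun t => (abs_add_le _ _).trans (add_le_add (hC t) (hA t))⟩
    have hum : ∃ C, ∀ t, |u t - a 0 t| ≤ C := by
      obtain ⟨C, hC⟩ := hu
      obtain ⟨A, hA⟩ := ha 0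
      exact ⟨C + A, fun t => (abs_sub _ _).trans (add_le_add (hC t) (hA t))⟩
    have i1 := ih (fun t => u t + a 0 t) (fun i => a i.succ) (fun i => φ i.succ) hup
      (fun i => ha i.succ) (fun i => hφ i.succ)
    have i2 := ih (fun t => u t - a 0 t) (fun i => a i.succ) (fun i => φ i.succ) hum
      (fun i => ha i.succ) (fun i => hφ i.succ)
    refine (add_le_add i1 i2).trans (le_of_eq ?_)
    rw [← Finset.sum_add_distrib]
    refine Finset.sum_congr rfl fun ε _ => ?_
    congr 2 <;> · funext t; ring

variable {H : Type*} [NormedAddCommGroup H] [InnerProductSpace ℝ H]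

theorem sum_signs_norm_sq (n : ℕ) : ∀ (v : H) (ψ : Fin n → H),
    ∑ ε : Fin n → Bool, ‖v + ∑ i, boolSign (ε i) • ψ i‖ ^ 2 = 2 ^ n * (‖v‖ ^ 2 + ∑ i, ‖ψ i‖ ^ 2) := by
  induction n with
  | zero => intro v ψ; simp
  | succ n ih =>
    intro v ψ
    rw [sum_signs_succ]
    simp only [Fin.sum_univ_succ, Fin.cons_zero, Fin.cons_succ, boolSign_true, boolSign_false,
      one_smul, neg_smul, ← add_assoc, Finset.sum_add_distrib]
    rw [ih, ih, ← sub_eq_add_neg]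
    have := parallelogram_law_with_norm ℝ v (ψ 0)
    rw [pow_succ]
    linear_combination (2 : ℝ) ^ n * this

theorem sum_signs_norm_le {n : ℕ} {ψ : Fin n → H} {κ : ℝ} (hκ : 0 ≤ κ) (hψ : ∀ i, ‖ψ i‖ ≤ κ) :
    ∑ ε : Fin n → Bool, ‖∑ i, boolSign (ε i) • ψ i‖ ≤ 2 ^ n * (√n * κ) := by
  have h1 := sum_signs_norm_sq n (0 : H) ψ
  simp only [zero_add, norm_zero, ne_eq, OfNat.ofNat_ne_zero, not_false_eq_true, zero_pow] at h1
  have h2 : ∑ i, ‖ψ i‖ ^ 2 ≤ n * κ ^ 2 := by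
    refine (Finset.sum_le_sum fun i _ => pow_le_pow_left₀ (norm_nonneg _) (hψ i) 2).trans ?_
    simp
  have h3 := sq_sum_le_card_mul_sum_sq (s := (Finset.univ : Finset (Fin n → Bool)))
    (f := fun ε => ‖∑ i, boolSign (ε i) • ψ i‖)
  rw [h1] at h3
  simp only [Finset.card_univ, Fintype.card_fun, Fintype.card_bool, Fintype.card_fin,
    Nat.cast_pow, Nat.cast_ofNat] at h3
  refine le_of_sq_le_sq ?_ (by positivity)
  refine h3.trans ?_
  rw [mul_pow, mul_pow, Real.sq_sqrt (Nat.cast_nonneg n), ← mul_assoc, ← sq]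
  exact mul_le_mul_of_nonneg_left h2 (by positivity)

/-- The Rademacher average of a bounded Lipschitz loss over a ball. -/
theorem sum_signs_iSup_ball_le {n : ℕ} {ψ : Fin n → H} {φ : Fin n → ℝ → ℝ} {κ ρ : ℝ} (hκ : 0 ≤ κ)
    (hρ : 0 ≤ ρ) (hψ : ∀ i, ‖ψ i‖ ≤ κ) (hφ : ∀ i x y, |φ i x - φ i y| ≤ |x - y|) :
    ∑ ε : Fin n → Bool, (⨆ h : Metric.closedBall (0 : H) ρ,
      ∑ i, boolSign (ε i) * φ i (inner ℝ (h : H) (ψ i))) ≤ 2 ^ n * (√n * (ρ * κ)) := by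
  have : Nonempty (Metric.closedBall (0 : H) ρ) := ⟨⟨0, by simpa using hρ⟩⟩
  have hb : ∀ i, ∃ C, ∀ h : Metric.closedBall (0 : H) ρ, |inner ℝ (h : H) (ψ i)| ≤ C := fun i =>
    ⟨ρ * κ, fun h => (abs_real_inner_le_norm _ _).trans
      (mul_le_mul (mem_closedBall_zero_iff.1 h.2) (hψ i) (norm_nonneg _) hρ)⟩
  have h1 := sum_signs_iSup_contraction n (fun _ : Metric.closedBall (0 : H) ρ => 0)
    (fun i h => inner ℝ (h : H) (ψ i)) φ ⟨0, by simp⟩ hb hφ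
  simp only [zero_add] at h1
  refine h1.trans ?_
  have h2 : ∀ ε : Fin n → Bool, (⨆ h : Metric.closedBall (0 : H) ρ,
      ∑ i, boolSign (ε i) * inner ℝ (h : H) (ψ i)) ≤ ρ * ‖∑ i, boolSign (ε i) • ψ i‖ := fun ε => by
    refine ciSup_le fun h => ?_
    simp_rw [← real_inner_smul_right]
    rw [← inner_sum]
    exact (real_inner_le_norm _ _).trans
      (mul_le_mul_of_nonneg_right (mem_closedBall_zero_iff.1 h.2) (norm_nonneg _))
  refine (Finset.sum_le_sum fun ε _ => h2 ε).trans ?_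
  rw [← Finset.mul_sum]
  calc _ ≤ ρ * (2 ^ n * (√n * κ)) := mul_le_mul_of_nonneg_left (sum_signs_norm_le hκ hψ) hρ
    _ = _ := by ring

end Rademacher

section Deviation

variable {H : Type*} [NormedAddCommGroup H] [InnerProductSpace ℝ H]

/-- The radial retraction onto the ball of radius `ρ`. -/
def ballRetract (ρ : ℝ) (v : H) : H := (ρ / max ρ ‖v‖) • v

theorem norm_ballRetract_le {ρ : ℝ} (hρ : 0 < ρ) (v : H) : ‖ballRetract ρ v‖ ≤ ρ := by
  have hm : 0 < max ρ ‖v‖ := lt_max_of_lt_left hρ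
  rw [ballRetract, norm_smul, Real.norm_of_nonneg (by positivity), div_mul_eq_mul_div,
    div_le_iff₀ hm]
  exact mul_le_mul_of_nonneg_left (le_max_right _ _) hρ.le

theorem ballRetract_of_norm_le {ρ : ℝ} (hρ : 0 < ρ) {v : H} (hv : ‖v‖ ≤ ρ) :
    ballRetract ρ v = v := by
  rw [ballRetract, max_eq_left hv, div_self hρ.ne', one_smul]

theorem continuous_ballRetract {ρ : ℝ} (hρ : 0 < ρ) : Continuous (ballRetract ρ : H → H) := by
  unfold ballRetract
  refine Continuous.smul (Continuous.div continuous_const (by fun_prop) fun v => ?_) continuous_id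
  exact (lt_max_of_lt_left hρ).ne'

variable {Z : Type*} {n : ℕ} (ψ : Z → H) (φ : Z → ℝ → ℝ)

/-- The members of a family of pairs. -/
def pairPoint (w : Fin n → Z × Z) (k : Fin n × Bool) : Z :=
  if k.2 then (w k.1).2 else (w k.1).1

/-- The linear combinations of the features of a family of pairs. -/
def pairComb (w : Fin n → Z × Z) (c : Fin n × Bool → ℝ) : H :=
  ∑ k, c k • ψ (pairPoint w k)

/-- The difference between the losses of `h` on the second and on the first members of pairs. -/
def pairDev (w : Fin n → Z × Z) (h : H) : ℝ :=
  ∑ i, (φ (w i).2 (inner ℝ h (ψ (w i).2)) - φ (w i).1 (inner ℝ h (ψ (w i).1)))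

/-- The positive part of the supremum of `pairDev` over the ball of radius `ρ`, written as a
countable supremum. -/
def supPairDev (ρ : ℝ) (w : Fin n → Z × Z) : ENNReal :=
  ⨆ c : Fin n × Bool → ℚ,
    ENNReal.ofReal (pairDev ψ φ w (ballRetract ρ (pairComb ψ w fun k => (c k : ℝ))))

variable {ψ φ}

theorem continuous_of_abs_sub_le {f : ℝ → ℝ} (hf : ∀ x y, |f x - f y| ≤ |x - y|) :
    Continuous f :=
  (LipschitzWith.of_dist_le_mul (K := 1) fun x y => by
    simpa [Real.dist_eq] using hf x y).continuous

theorem continuous_pairDev (hφ : ∀ z x y, |φ z x - φ z y| ≤ |x - y|) (w : Fin n → Z × Z) :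
    Continuous (pairDev ψ φ w) := by
  have := fun z => continuous_of_abs_sub_le (hφ z)
  unfold pairDev
  refine continuous_finsetSum _ fun i _ => Continuous.sub ?_ ?_
  · exact (this _).comp (by fun_prop)
  · exact (this _).comp (by fun_prop)

theorem ofReal_pairDev_le {ρ : ℝ} (hρ : 0 < ρ) (hφ : ∀ z x y, |φ z x - φ z y| ≤ |x - y|)
    (w : Fin n → Z × Z) {h : H} (hh : ‖h‖ ≤ ρ) :
    ENNReal.ofReal (pairDev ψ φ w h) ≤ supPairDev ψ φ ρ w := by
  set V : Submodule ℝ H := Submodule.span ℝ (Set.range fun k => ψ (pairPoint w k)) with hV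
  have hfin : FiniteDimensional ℝ V := FiniteDimensional.span_of_finite ℝ (Set.finite_range _)
  set h' : H := V.starProjection h with hh'
  have hin : ∀ k, inner ℝ h (ψ (pairPoint w k)) = inner ℝ h' (ψ (pairPoint w k)) := fun k => by
    have := V.starProjection_inner_eq_zero h (ψ (pairPoint w k))
      (Submodule.subset_span (Set.mem_range_self k))
    rw [inner_sub_left, sub_eq_zero] at this
    exact this
  have hdev : pairDev ψ φ w h = pairDev ψ φ w h' := by
    unfold pairDev
    refine Finset.sum_congr rfl fun i _ => ?_
    have h1 := hin (i, true)
    have h2 := hin (i, false)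
    simp only [pairPoint, if_true, Bool.false_eq_true, if_false] at h1 h2
    rw [h1, h2]
  have hnorm : ‖h'‖ ≤ ρ := (V.norm_starProjection_apply_le h).trans hh
  obtain ⟨c, hc⟩ := (Submodule.mem_span_range_iff_exists_fun ℝ).1
    (show h' ∈ Submodule.span ℝ (Set.range fun k => ψ (pairPoint w k)) from
      V.starProjection_apply_mem h)
  have hcl : IsClosed {c : Fin n × Bool → ℝ |
      ENNReal.ofReal (pairDev ψ φ w (ballRetract ρ (pairComb ψ w c))) ≤ supPairDev ψ φ ρ w} := by
    refine isClosed_le (ENNReal.continuous_ofReal.comp ((continuous_pairDev hφ w).comp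
      ((continuous_ballRetract hρ).comp ?_))) continuous_const
    unfold pairComb
    fun_prop
  have hdense : DenseRange (fun (c : Fin n × Bool → ℚ) k => (c k : ℝ)) :=
    DenseRange.piMap fun _ => Rat.denseRange_cast
  have hall := hdense.induction_on (p := fun c => ENNReal.ofReal
    (pairDev ψ φ w (ballRetract ρ (pairComb ψ w c))) ≤ supPairDev ψ φ ρ w) c hcl
    fun q => le_iSup (fun c : Fin n × Bool → ℚ => ENNReal.ofReal
      (pairDev ψ φ w (ballRetract ρ (pairComb ψ w fun k => (c k : ℝ))))) q
  have e : pairComb ψ w c = h' := hc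
  rw [e, ballRetract_of_norm_le hρ hnorm] at hall
  rwa [hdev]

section Measurability

variable [MeasurableSpace Z]

theorem measurable_pairPoint (k : Fin n × Bool) :
    Measurable fun w : Fin n → Z × Z => pairPoint w k := by
  unfold pairPoint
  split_ifs <;> fun_prop

theorem measurable_inner_pairComb (hψ : Measurable fun p : Z × Z => inner ℝ (ψ p.1) (ψ p.2))
    (c : Fin n × Bool → ℝ) (k : Fin n × Bool) :
    Measurable fun w : Fin n → Z × Z =>
      inner ℝ (pairComb ψ w c) (ψ (pairPoint w k)) := by
  simp only [pairComb, sum_inner, real_inner_smul_left]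
  exact Finset.measurable_sum _ fun i _ => (hψ.comp
    ((measurable_pairPoint i).prodMk (measurable_pairPoint k))).const_mul _

theorem measurable_supPairDev (hψ : Measurable fun p : Z × Z => inner ℝ (ψ p.1) (ψ p.2))
    (hφ : Measurable (Function.uncurry φ)) (ρ : ℝ) :
    Measurable (supPairDev ψ φ ρ : (Fin n → Z × Z) → ENNReal) := by
  refine Measurable.iSup fun c => ENNReal.measurable_ofReal.comp ?_
  set c' : Fin n × Bool → ℝ := fun k => (c k : ℝ)
  have hnorm : Measurable fun w : Fin n → Z × Z => ‖pairComb ψ w c'‖ := by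
    have : ∀ w : Fin n → Z × Z, ‖pairComb ψ w c'‖ =
        √(∑ k, c' k * inner ℝ (pairComb ψ w c') (ψ (pairPoint w k))) := fun w => by
      rw [norm_eq_sqrt_real_inner]
      conv_lhs => rw [show inner ℝ (pairComb ψ w c') (pairComb ψ w c') =
        inner ℝ (pairComb ψ w c') (∑ k, c' k • ψ (pairPoint w k)) from rfl]
      simp only [inner_sum, real_inner_smul_right]
    simp only [this]
    exact (Finset.measurable_sum _ fun k _ =>
      (measurable_inner_pairComb hψ c' k).const_mul _).sqrt
  have hin : ∀ k, Measurable fun w : Fin n → Z × Z =>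
      inner ℝ (ballRetract ρ (pairComb ψ w c')) (ψ (pairPoint w k)) := fun k => by
    simp only [ballRetract, real_inner_smul_left]
    exact ((measurable_const.max hnorm).const_div ρ).mul (measurable_inner_pairComb hψ c' k)
  unfold pairDev
  refine Finset.measurable_sum _ fun i _ => Measurable.sub ?_ ?_
  · exact hφ.comp ((measurable_pairPoint (i, true)).prodMk (hin (i, true)))
  · exact hφ.comp ((measurable_pairPoint (i, false)).prodMk (hin (i, false)))

end Measurability

/-- Exchange of the members of the pairs selected by `ε`. -/
def pairSwap (ε : Fin n → Bool) (w : Fin n → Z × Z) (i : Fin n) : Z × Z :=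
  if ε i then w i else (w i).swap

theorem pairDev_pairSwap (ε : Fin n → Bool) (w : Fin n → Z × Z) (h : H) :
    pairDev ψ φ (pairSwap ε w) h = ∑ i, boolSign (ε i) *
      (φ (w i).2 (inner ℝ h (ψ (w i).2)) - φ (w i).1 (inner ℝ h (ψ (w i).1))) := by
  unfold pairDev pairSwap
  refine Finset.sum_congr rfl fun i _ => ?_
  cases ε i <;> simp

/-- The Rademacher average of the losses of the sample `z` over the ball of radius `ρ`, for a given
choice of signs, plus the absolute value of the term of `h = 0`. -/
def signedSup (ψ : Z → H) (φ : Z → ℝ → ℝ) (ρ : ℝ) (z : Fin n → Z) (ε : Fin n → Bool) : ℝ :=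
  (⨆ h : Metric.closedBall (0 : H) ρ,
    ∑ i, boolSign (ε i) * (φ (z i) (inner ℝ (h : H) (ψ (z i))) - φ (z i) 0)) +
  |∑ i, boolSign (ε i) * φ (z i) 0|

variable {ρ κ L₀ : ℝ}

theorem le_signedSup (hψ : ∀ z, ‖ψ z‖ ≤ κ) (hρ : 0 ≤ ρ)
    (hφ : ∀ z x y, |φ z x - φ z y| ≤ |x - y|) (z : Fin n → Z) (ε : Fin n → Bool) :
    0 ≤ signedSup ψ φ ρ z ε ∧ ∀ h : H, ‖h‖ ≤ ρ →
      ∑ i, boolSign (ε i) * φ (z i) (inner ℝ h (ψ (z i))) ≤ signedSup ψ φ ρ z ε := by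
  have hbdd : BddAbove (Set.range fun h : Metric.closedBall (0 : H) ρ =>
      ∑ i, boolSign (ε i) * (φ (z i) (inner ℝ (h : H) (ψ (z i))) - φ (z i) 0)) := by
    refine ⟨∑ i : Fin n, ρ * κ, ?_⟩
    rintro _ ⟨h, rfl⟩
    refine Finset.sum_le_sum fun i _ => (le_abs_self _).trans ?_
    rw [abs_mul, abs_boolSign, one_mul]
    refine (hφ _ _ _).trans ?_
    rw [sub_zero]
    exact (abs_real_inner_le_norm _ _).trans
      (mul_le_mul (mem_closedBall_zero_iff.1 h.2) (hψ _) (norm_nonneg _) hρ)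
  constructor
  · refine add_nonneg ?_ (abs_nonneg _)
    refine le_trans (le_of_eq ?_) (le_ciSup hbdd ⟨0, by simpa using hρ⟩)
    simp
  · intro h hh
    have h1 := le_ciSup hbdd ⟨h, mem_closedBall_zero_iff.2 hh⟩
    have h2 := le_abs_self (∑ i, boolSign (ε i) * φ (z i) 0)
    refine le_trans (le_of_eq ?_) (add_le_add h1 h2)
    rw [← Finset.sum_add_distrib]
    exact Finset.sum_congr rfl fun i _ => by ring

theorem sum_signedSup_le (hκ : 0 ≤ κ) (hψ : ∀ z, ‖ψ z‖ ≤ κ) (hρ : 0 ≤ ρ)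
    (hφ : ∀ z x y, |φ z x - φ z y| ≤ |x - y|) (hL : 0 ≤ L₀) (hφ0 : ∀ z, |φ z 0| ≤ L₀)
    (z : Fin n → Z) :
    ∑ ε, signedSup ψ φ ρ z ε ≤ 2 ^ n * (√n * (ρ * κ + L₀)) := by
  unfold signedSup
  rw [Finset.sum_add_distrib]
  have h1 := sum_signs_iSup_ball_le (ψ := fun i => ψ (z i))
    (φ := fun i t => φ (z i) t - φ (z i) 0) hκ hρ (fun i => hψ _)
    (fun i x y => by simpa using hφ (z i) x y)
  have h2 := sum_signs_norm_le (ψ := fun i => φ (z i) 0) hL (fun i => hφ0 _)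
  simp only [smul_eq_mul, Real.norm_eq_abs] at h2
  calc _ ≤ 2 ^ n * (√n * (ρ * κ)) + 2 ^ n * (√n * L₀) := add_le_add h1 h2
    _ = _ := by ring

theorem sum_supPairDev_pairSwap_le (hκ : 0 ≤ κ) (hψ : ∀ z, ‖ψ z‖ ≤ κ) (hρ : 0 < ρ)
    (hφ : ∀ z x y, |φ z x - φ z y| ≤ |x - y|) (hL : 0 ≤ L₀) (hφ0 : ∀ z, |φ z 0| ≤ L₀)
    (w : Fin n → Z × Z) :
    ∑ ε, supPairDev ψ φ ρ (pairSwap ε w) ≤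
      2 ^ n * ENNReal.ofReal (2 * (√n * (ρ * κ + L₀))) := by
  set z₁ : Fin n → Z := fun i => (w i).1
  set z₂ : Fin n → Z := fun i => (w i).2
  have h1 : ∀ ε, supPairDev ψ φ ρ (pairSwap ε w) ≤
      ENNReal.ofReal (signedSup ψ φ ρ z₂ ε + signedSup ψ φ ρ z₁ fun i => !ε i) := fun ε => by
    refine iSup_le fun c => ENNReal.ofReal_le_ofReal ?_
    rw [pairDev_pairSwap]
    have hb := norm_ballRetract_le hρ (pairComb ψ (pairSwap ε w) fun k => (c k : ℝ))
    refine le_trans (le_of_eq ?_) (add_le_add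
      ((le_signedSup hψ hρ.le hφ z₂ ε).2 _ hb) ((le_signedSup hψ hρ.le hφ z₁ fun i => !ε i).2 _ hb))
    rw [← Finset.sum_add_distrib]
    refine Finset.sum_congr rfl fun i _ => ?_
    rw [boolSign_not]; ring
  refine (Finset.sum_le_sum fun ε _ => h1 ε).trans ?_
  rw [← ENNReal.ofReal_sum_of_nonneg fun ε _ =>
    add_nonneg (le_signedSup hψ hρ.le hφ _ _).1 (le_signedSup hψ hρ.le hφ _ _).1,
    Finset.sum_add_distrib]
  have h2 : ∑ ε : Fin n → Bool, signedSup ψ φ ρ z₁ (fun i => !ε i) =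
      ∑ ε : Fin n → Bool, signedSup ψ φ ρ z₁ ε :=
    (Equiv.arrowCongr (Equiv.refl (Fin n)) Equiv.boolNot).sum_comp (signedSup ψ φ ρ z₁)
  rw [h2]
  have e : (2 : ENNReal) ^ n = ENNReal.ofReal (2 ^ n) := by
    rw [ENNReal.ofReal_pow (by norm_num)]; norm_num
  rw [e, ← ENNReal.ofReal_mul (by positivity)]
  refine ENNReal.ofReal_le_ofReal ?_
  have := sum_signedSup_le hκ hψ hρ.le hφ hL hφ0 z₁
  have := sum_signedSup_le hκ hψ hρ.le hφ hL hφ0 z₂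
  linarith

variable [MeasurableSpace Z] (P : Measure Z) [IsProbabilityMeasure P]

theorem measurePreserving_pairSwap (ε : Fin n → Bool) :
    MeasurePreserving (pairSwap (Z := Z) ε) (Measure.pi fun _ => P.prod P)
      (Measure.pi fun _ => P.prod P) := by
  refine measurePreserving_pi (f := fun i p => if ε i then p else p.swap)
    (fun _ : Fin n => P.prod P) (fun _ => P.prod P) fun i => ?_
  cases ε i
  · simpa using Measure.measurePreserving_swap
  · simp only [if_true]
    exact MeasurePreserving.id _

theorem lintegral_supPairDev_le (hψm : Measurable fun p : Z × Z => inner ℝ (ψ p.1) (ψ p.2))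
    (hφm : Measurable (Function.uncurry φ)) (hκ : 0 ≤ κ) (hψ : ∀ z, ‖ψ z‖ ≤ κ) (hρ : 0 < ρ)
    (hφ : ∀ z x y, |φ z x - φ z y| ≤ |x - y|) (hL : 0 ≤ L₀) (hφ0 : ∀ z, |φ z 0| ≤ L₀) :
    ∫⁻ w : Fin n → Z × Z, supPairDev ψ φ ρ w ∂(Measure.pi fun _ => P.prod P) ≤
      ENNReal.ofReal (2 * (√n * (ρ * κ + L₀))) := by
  have hm := measurable_supPairDev (n := n) hψm hφm ρ
  have h1 : (2 : ENNReal) ^ n *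
      ∫⁻ w : Fin n → Z × Z, supPairDev ψ φ ρ w ∂(Measure.pi fun _ => P.prod P) =
      ∫⁻ w : Fin n → Z × Z, ∑ ε : Fin n → Bool, supPairDev ψ φ ρ (pairSwap ε w)
        ∂(Measure.pi fun _ => P.prod P) := by
    rw [lintegral_finsetSum (f := fun (ε : Fin n → Bool) (w : Fin n → Z × Z) =>
      supPairDev ψ φ ρ (pairSwap ε w)) _
      fun ε _ => hm.comp (measurePreserving_pairSwap P ε).measurable]
    have : ∀ ε : Fin n → Bool, ∫⁻ w : Fin n → Z × Z, supPairDev ψ φ ρ (pairSwap ε w)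
        ∂(Measure.pi fun _ => P.prod P) = ∫⁻ w : Fin n → Z × Z, supPairDev ψ φ ρ w
        ∂(Measure.pi fun _ => P.prod P) := fun ε =>
      (measurePreserving_pairSwap P ε).lintegral_comp hm
    simp only [this, Finset.sum_const, Finset.card_univ, Fintype.card_fun, Fintype.card_bool,
      Fintype.card_fin, nsmul_eq_mul, Nat.cast_pow, Nat.cast_ofNat]
  have h2 : (2 : ENNReal) ^ n *
      ∫⁻ w : Fin n → Z × Z, supPairDev ψ φ ρ w ∂(Measure.pi fun _ => P.prod P) ≤
      2 ^ n * ENNReal.ofReal (2 * (√n * (ρ * κ + L₀))) := by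
    rw [h1]
    refine (lintegral_mono fun w =>
      sum_supPairDev_pairSwap_le hκ hψ hρ hφ hL hφ0 w).trans ?_
    simp
  exact (ENNReal.mul_le_mul_iff_right (by simp) (by simp)).1 h2

/-- Measurability of `z ↦ ⟪h, ψ z⟫` only needs that of the kernel of `ψ`. -/
theorem measurable_inner_feature [CompleteSpace H]
    (hψm : Measurable fun p : Z × Z => inner ℝ (ψ p.1) (ψ p.2)) (h : H) :
    Measurable fun z => inner ℝ h (ψ z) := by
  let M : Submodule ℝ H :=
    { carrier := {h | Measurable fun z => inner ℝ h (ψ z)}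
      zero_mem' := by simp
      add_mem' := fun {a b} ha hb => by
        simp only [Set.mem_ofPred_eq, inner_add_left] at *
        exact ha.add hb
      smul_mem' := fun c a ha => by
        simp only [Set.mem_ofPred_eq, real_inner_smul_left] at *
        exact ha.const_mul c }
  have hcl : IsClosed (M : Set H) := by
    refine IsSeqClosed.isClosed fun u a hu hua => ?_
    exact measurable_of_tendsto_metrizable (fun k => hu k)
      (tendsto_pi_nhds.2 fun z => (hua.inner tendsto_const_nhds))
  have hcomplete : CompleteSpace M := hcl.completeSpace_coe
  have hbot : Mᗮ = ⊥ := by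
    rw [Submodule.eq_bot_iff]
    intro x hx
    have h0 : ∀ z, inner ℝ x (ψ z) = 0 := fun z =>
      Submodule.inner_left_of_mem_orthogonal (K := M)
        (show Measurable fun z' => inner ℝ (ψ z) (ψ z') from
          hψm.comp (measurable_const.prodMk measurable_id)) hx
    have hxM : x ∈ M := by
      show Measurable fun z => inner ℝ x (ψ z)
      simp [h0]
    exact inner_self_eq_zero.1 (Submodule.inner_right_of_mem_orthogonal hxM hx)
  have htop : M = ⊤ := Submodule.orthogonal_eq_bot_iff.1 hbot
  exact (htop ▸ Submodule.mem_top : h ∈ M)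

theorem ofReal_integral_le {α : Type*} [MeasurableSpace α] {μ : Measure α} {f : α → ℝ}
    (hf : Integrable f μ) : ENNReal.ofReal (∫ x, f x ∂μ) ≤ ∫⁻ x, ENNReal.ofReal (f x) ∂μ := by
  have h1 : ∫ x, f x ∂μ ≤ ∫ x, max (f x) 0 ∂μ :=
    integral_mono hf hf.pos_part fun x => le_max_left _ _
  refine (ENNReal.ofReal_le_ofReal h1).trans ?_
  rw [ofReal_integral_eq_lintegral_ofReal hf.pos_part
    (Filter.Eventually.of_forall fun x => le_max_right _ _)]
  refine lintegral_mono fun x => ?_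
  rcases le_total 0 (f x) with h | h
  · rw [max_eq_left h]
  · simp [max_eq_right h]

/-- Uniform deviation over the ball of radius `ρ` of a Hilbert space, for a Lipschitz loss of a
linear functional. -/
theorem exists_uniform_deviation [CompleteSpace H]
    (hψm : Measurable fun p : Z × Z => inner ℝ (ψ p.1) (ψ p.2))
    (hφm : Measurable (Function.uncurry φ)) (hκ : 0 ≤ κ) (hψ : ∀ z, ‖ψ z‖ ≤ κ) (hρ : 0 < ρ)
    (hφ : ∀ z x y, |φ z x - φ z y| ≤ |x - y|) (hL : 0 ≤ L₀) (hφ0 : ∀ z, |φ z 0| ≤ L₀) (n : ℕ) :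
    ∃ Φ : (Fin n → Z) → ENNReal, Measurable Φ ∧
      ∫⁻ S, Φ S ∂(Measure.pi fun _ => P) ≤ ENNReal.ofReal (2 * (√n * (ρ * κ + L₀))) ∧
      ∀ S, ∀ h : H, ‖h‖ ≤ ρ → ENNReal.ofReal (n * ∫ z, φ z (inner ℝ h (ψ z)) ∂P -
        ∑ i, φ (S i) (inner ℝ h (ψ (S i)))) ≤ Φ S := by
  set e := MeasurableEquiv.arrowProdEquivProdArrow Z Z (Fin n) with he
  have hmp := measurePreserving_arrowProdEquivProdArrow Z Z (Fin n) (fun _ => P) (fun _ => P)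
  have hm := measurable_supPairDev (n := n) hψm hφm ρ
  have hme : Measurable fun p : (Fin n → Z) × (Fin n → Z) => supPairDev ψ φ ρ (e.symm p) :=
    hm.comp e.symm.measurable
  refine ⟨fun S => ∫⁻ S', supPairDev ψ φ ρ (e.symm (S, S')) ∂(Measure.pi fun _ => P),
    hme.lintegral_prod_right', ?_, fun S h hh => ?_⟩
  · rw [← lintegral_prod _ hme.aemeasurable, ← hmp.lintegral_comp hme]
    simp only [he, MeasurableEquiv.symm_apply_apply]
    exact lintegral_supPairDev_le P hψm hφm hκ hψ hρ hφ hL hφ0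
  · have hmeas : Measurable fun z => φ z (inner ℝ h (ψ z)) :=
      hφm.comp (measurable_id.prodMk (measurable_inner_feature hψm h))
    have hintegr : Integrable (fun z => φ z (inner ℝ h (ψ z))) P := by
      refine Integrable.of_bound hmeas.aestronglyMeasurable (L₀ + ρ * κ)
        (Filter.Eventually.of_forall fun z => ?_)
      have h1 := hφ z (inner ℝ h (ψ z)) 0
      rw [sub_zero] at h1
      have h2 : |inner ℝ h (ψ z)| ≤ ρ * κ := (abs_real_inner_le_norm _ _).trans
        (mul_le_mul hh (hψ z) (norm_nonneg _) hρ.le)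
      have h3 := abs_add_le (φ z 0) (φ z (inner ℝ h (ψ z)) - φ z 0)
      rw [add_sub_cancel] at h3
      rw [Real.norm_eq_abs]
      linarith [hφ0 z]
    have hinti : ∀ i : Fin n, Integrable (fun S' : Fin n → Z => φ (S' i) (inner ℝ h (ψ (S' i))))
        (Measure.pi fun _ => P) := fun i =>
      integrable_comp_eval (μ := fun _ : Fin n => P) (i := i) hintegr
    have hsum : n * ∫ z, φ z (inner ℝ h (ψ z)) ∂P - ∑ i, φ (S i) (inner ℝ h (ψ (S i))) =
        ∫ S' : Fin n → Z, pairDev ψ φ (e.symm (S, S')) h ∂(Measure.pi fun _ => P) := by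
      have e1 : ∀ S' : Fin n → Z, pairDev ψ φ (e.symm (S, S')) h =
          ∑ i, φ (S' i) (inner ℝ h (ψ (S' i))) - ∑ i, φ (S i) (inner ℝ h (ψ (S i))) := fun S' => by
        rw [← Finset.sum_sub_distrib]; rfl
      simp only [e1]
      rw [integral_sub (integrable_finsetSum _ fun i _ => hinti i) (integrable_const _),
        integral_finsetSum _ fun i _ => hinti i]
      have e2 : ∀ i : Fin n, ∫ S' : Fin n → Z, φ (S' i) (inner ℝ h (ψ (S' i)))
          ∂(Measure.pi fun _ => P) = ∫ z, φ z (inner ℝ h (ψ z)) ∂P := fun i =>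
        integral_comp_eval (μ := fun _ : Fin n => P) (i := i) hintegr.aestronglyMeasurable
      simp [e2]
    have hintd : Integrable (fun S' : Fin n → Z => pairDev ψ φ (e.symm (S, S')) h)
        (Measure.pi fun _ => P) := by
      show Integrable (fun S' : Fin n → Z => ∑ i, (φ (S' i) (inner ℝ h (ψ (S' i))) -
        φ (S i) (inner ℝ h (ψ (S i))))) _
      exact integrable_finsetSum _ fun i _ => (hinti i).sub (integrable_const _)
    rw [hsum]
    exact (ofReal_integral_le hintd).trans
      (lintegral_mono fun S' => ofReal_pairDev_le hρ hφ _ hh)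

end Deviation

section Ridge

theorem norm_le_of_ridge_minimizer {H : Type*} [NormedAddCommGroup H] {E : H → ℝ} {lam L₀ : ℝ}
    (hlam : 0 < lam) (h0 : ∀ h, 0 ≤ E h)
    (hE : E 0 ≤ L₀) {h : H} (hh : ∀ g, E h + lam / 2 * ‖h‖ ^ 2 ≤ E g + lam / 2 * ‖g‖ ^ 2) :
    ‖h‖ ≤ √(2 * L₀) / √lam := by
  rw [← Real.sqrt_div' _ hlam.le]
  refine Real.le_sqrt_of_sq_le ?_
  have h1 := hh 0
  rw [norm_zero] at h1
  rw [le_div_iff₀ hlam]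
  nlinarith [h0 h]

variable {H : Type*} [NormedAddCommGroup H] [InnerProductSpace ℝ H]

theorem norm_midpoint_sq (g h : H) :
    ‖(1 / 2 : ℝ) • (g + h)‖ ^ 2 = (‖g‖ ^ 2 + ‖h‖ ^ 2) / 2 - ‖g - h‖ ^ 2 / 4 := by
  have := parallelogram_law_with_norm ℝ g h
  rw [norm_smul, mul_pow]
  norm_num
  linarith

/-- Two near-minimizers of a ridge-regularized midpoint convex function are close. -/
theorem norm_sub_sq_le_of_near_min {E : H → ℝ} {lam d η : ℝ} (hlam : 0 < lam)
    (hm : ∀ g h, E ((1 / 2 : ℝ) • (g + h)) ≤ (E g + E h) / 2)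
    (hd : ∀ g, d ≤ E g + lam / 2 * ‖g‖ ^ 2) {g h : H}
    (hg : E g + lam / 2 * ‖g‖ ^ 2 ≤ d + η) (hh : E h + lam / 2 * ‖h‖ ^ 2 ≤ d + η) :
    ‖g - h‖ ^ 2 ≤ 8 / lam * η := by
  have h1 := hd ((1 / 2 : ℝ) • (g + h))
  rw [norm_midpoint_sq] at h1
  have h2 := hm g h
  rw [div_mul_eq_mul_div, le_div_iff₀ hlam]
  nlinarith

theorem existsUnique_ridge_minimizer [CompleteSpace H] {E : H → ℝ} {lam : ℝ} (hlam : 0 < lam)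
    (hc : Continuous E) (h0 : ∀ h, 0 ≤ E h)
    (hm : ∀ g h, E ((1 / 2 : ℝ) • (g + h)) ≤ (E g + E h) / 2) :
    ∃! h, ∀ g, E h + lam / 2 * ‖h‖ ^ 2 ≤ E g + lam / 2 * ‖g‖ ^ 2 := by
  set F : H → ℝ := fun g => E g + lam / 2 * ‖g‖ ^ 2 with hF
  have hFc : Continuous F := by fun_prop
  have hbdd : BddBelow (Set.range F) := ⟨0, by
    rintro _ ⟨g, rfl⟩
    have := h0 g
    positivity⟩
  set d := ⨅ g, F g
  have hd : ∀ g, d ≤ F g := fun g => ciInf_le hbdd g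
  have hex : ∀ k : ℕ, ∃ g, F g ≤ d + 1 / ((k : ℝ) + 1) := fun k => by
    obtain ⟨g, hg⟩ := exists_lt_of_ciInf_lt (show d < d + 1 / ((k : ℝ) + 1) by
      have : (0 : ℝ) < 1 / ((k : ℝ) + 1) := by positivity
      linarith)
    exact ⟨g, hg.le⟩
  choose g hg using hex
  have hlim0 : Filter.Tendsto (fun k : ℕ => √(8 / lam * (1 / ((k : ℝ) + 1)))) Filter.atTop
      (nhds 0) := by
    have := ((tendsto_one_div_add_atTop_nhds_zero_nat (𝕜 := ℝ)).const_mul (8 / lam)).sqrt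
    simpa using this
  have hcauchy : CauchySeq g := by
    refine cauchySeq_of_le_tendsto_0 _ (fun i j N hi hj => ?_) hlim0
    rw [dist_eq_norm]
    refine Real.le_sqrt_of_sq_le ?_
    have hmono : ∀ {i : ℕ}, N ≤ i → F (g i) ≤ d + 1 / ((N : ℝ) + 1) := fun {i} hi =>
      (hg i).trans (by gcongr)
    exact norm_sub_sq_le_of_near_min hlam hm hd (hmono hi) (hmono hj)
  obtain ⟨h, hh⟩ := cauchySeq_tendsto_of_complete hcauchy
  have hmin : F h ≤ d := by
    have h1 := (hFc.tendsto h).comp hh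
    have h2 : Filter.Tendsto (fun k : ℕ => d + 1 / ((k : ℝ) + 1)) Filter.atTop (nhds d) := by
      simpa using (tendsto_one_div_add_atTop_nhds_zero_nat (𝕜 := ℝ)).const_add d
    exact le_of_tendsto_of_tendsto' h1 h2 hg
  refine ⟨h, fun g => hmin.trans (hd g), fun h' hh' => ?_⟩
  have h1 := norm_sub_sq_le_of_near_min (d := d) (η := 0) hlam hm hd (g := h') (h := h)
    (by simpa using (hh' h).trans hmin) (by simpa using hmin)
  rw [mul_zero] at h1
  have h2 : ‖h' - h‖ = 0 := by nlinarith [norm_nonneg (h' - h)]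
  exact sub_eq_zero.1 (norm_eq_zero.1 h2)

theorem neg_inner_le_of_ridge_minimizer {E : H → ℝ} {lam C : ℝ} (hlam : 0 < lam) {h : H}
    (hh : ∀ g, E h + lam / 2 * ‖h‖ ^ 2 ≤ E g + lam / 2 * ‖g‖ ^ 2) {g : H}
    (hg : ∀ t : ℝ, 0 < t → E (h + t • g) - E h ≤ t * C) : -(lam * inner ℝ h g) ≤ C := by
  refine le_of_forall_pos_le_add fun η hη => ?_
  set t : ℝ := η / (lam * (‖g‖ ^ 2 + 1)) with ht
  have hpos : 0 < lam * (‖g‖ ^ 2 + 1) := by positivity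
  have htpos : 0 < t := by positivity
  have h1 := hh (h + t • g)
  have h2 := hg t htpos
  rw [norm_add_sq_real, real_inner_smul_right, norm_smul, mul_pow, Real.norm_eq_abs, sq_abs] at h1
  have h3 : t * (lam * (‖g‖ ^ 2 + 1)) = η := div_mul_cancel₀ _ hpos.ne'
  have h4 : t * (-(lam * inner ℝ h g)) ≤ t * (C + lam / 2 * t * ‖g‖ ^ 2) := by nlinarith
  have h5 := le_of_mul_le_mul_left h4 htpos
  have h6 : 0 ≤ t * lam := by positivity
  nlinarith [sq_nonneg ‖g‖]

theorem abs_inner_le_of_ridge_minimizer {E : H → ℝ} {lam C : ℝ} (hlam : 0 < lam) {h : H}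
    (hh : ∀ g, E h + lam / 2 * ‖h‖ ^ 2 ≤ E g + lam / 2 * ‖g‖ ^ 2) {g : H}
    (hg : ∀ t : ℝ, E (h + t • g) - E h ≤ |t| * C) : |inner ℝ h g| ≤ C / lam := by
  have h1 := neg_inner_le_of_ridge_minimizer (C := C) hlam hh (g := g) fun t ht => by
    simpa [abs_of_pos ht] using hg t
  have h2 := neg_inner_le_of_ridge_minimizer (C := C) hlam hh (g := -g) fun t ht => by
    have := hg (-t)
    rw [abs_neg, abs_of_pos ht, neg_smul] at this
    simpa using this
  rw [inner_neg_right] at h2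
  rw [le_div_iff₀ hlam]
  calc |inner ℝ h g| * lam = |lam * inner ℝ h g| := by rw [abs_mul, abs_of_pos hlam, mul_comm]
    _ ≤ C := ?_
  rw [abs_le]
  constructor <;> linarith

end Ridge

section Loss

variable {τ : Task} {θ θ' y t s B : ℝ}

theorem loss_nonneg (hθ : θ ∈ Set.Icc τ.lo τ.hi) (y t : ℝ) : 0 ≤ τ.loss θ y t := by
  cases τ
  · simp only [Task.loss, Task.lo, Task.hi] at *
    rcases le_total 0 (y - t) with h | h
    · exact le_max_of_le_left (mul_nonneg hθ.1 h)
    · exact le_max_of_le_right (by nlinarith [hθ.2])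
  · exact mul_nonneg (abs_nonneg _) (le_max_right _ _)

theorem loss_midpoint_le (θ y s t : ℝ) :
    τ.loss θ y ((s + t) / 2) ≤ (τ.loss θ y s + τ.loss θ y t) / 2 := by
  cases τ
  · simp only [Task.loss]
    refine max_le ?_ ?_
    · have h1 := le_max_left (θ * (y - s)) ((θ - 1) * (y - s))
      have h2 := le_max_left (θ * (y - t)) ((θ - 1) * (y - t))
      linarith
    · have h1 := le_max_right (θ * (y - s)) ((θ - 1) * (y - s))
      have h2 := le_max_right (θ * (y - t)) ((θ - 1) * (y - t))
      linarith
  · simp only [Task.loss]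
    rw [← mul_add, mul_div_assoc]
    refine mul_le_mul_of_nonneg_left (max_le ?_ ?_) (abs_nonneg _)
    · have h1 := le_max_left (1 - y * s) 0
      have h2 := le_max_left (1 - y * t) 0
      linarith
    · have h1 := le_max_right (1 - y * s) 0
      have h2 := le_max_right (1 - y * t) 0
      linarith

theorem continuous_loss (θ y : ℝ) : Continuous (τ.loss θ y) := by
  cases τ
  · show Continuous fun t => max (θ * (y - t)) ((θ - 1) * (y - t))
    fun_prop
  · show Continuous fun t =>
      |(θ + 1) / 2 - Set.indicator {(-1 : ℝ)} (fun _ => 1) y| * max (1 - y * t) 0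
    fun_prop

theorem measurable_loss (θ : ℝ) : Measurable fun p : ℝ × ℝ => τ.loss θ p.1 p.2 := by
  cases τ
  · show Measurable fun p : ℝ × ℝ => max (θ * (p.1 - p.2)) ((θ - 1) * (p.1 - p.2))
    fun_prop
  · show Measurable fun p : ℝ × ℝ =>
      |(θ + 1) / 2 - Set.indicator {(-1 : ℝ)} (fun _ => 1) p.1| * max (1 - p.1 * p.2) 0
    have : Measurable fun p : ℝ × ℝ => Set.indicator {(-1 : ℝ)} (fun _ => (1 : ℝ)) p.1 :=
      (measurable_const.indicator (measurableSet_singleton _)).comp measurable_fst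
    fun_prop

theorem measurableSet_outputs (τ : Task) (B : ℝ) : MeasurableSet (τ.outputs B) := by
  cases τ
  · exact measurableSet_Icc
  · exact (Set.toFinite ({-1, 1} : Set ℝ)).measurableSet

/-- For admissible outputs, the loss is a product of affine functions plus the positive part of
another one. -/
theorem exists_loss_eq (hy : y ∈ τ.outputs B) : ∃ α₁ β₁ c₁ d₁ α₂ β₂ c₂ d₂ : ℝ,
    (|α₁| ≤ 1 ∧ |β₁| ≤ 1 ∧ |c₁| ≤ |B| + 1 ∧ |d₁| ≤ 1) ∧
    (|α₂| ≤ 1 ∧ |β₂| ≤ 1 ∧ |c₂| ≤ |B| + 1 ∧ |d₂| ≤ 1) ∧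
    ∀ θ ∈ Set.Icc τ.lo τ.hi, ∀ t, τ.loss θ y t =
      (α₁ + β₁ * θ) * (c₁ + d₁ * t) + max ((α₂ + β₂ * θ) * (c₂ + d₂ * t)) 0 := by
  have hB : 1 ≤ |B| + 1 := by linarith [abs_nonneg B]
  cases τ
  · have hyB : |y| ≤ |B| + 1 := by
      have := abs_le.2 hy
      linarith [le_abs_self B]
    refine ⟨0, 1, y, -1, 1, 0, -y, 1, by simpa using hyB, by simpa using hyB, fun θ _ t => ?_⟩
    simp only [Task.loss]
    rw [← max_add_add_left, max_comm]
    congr 1 <;> ring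
  · rcases hy with rfl | rfl
    · refine ⟨0, 0, 0, 0, 1 / 2, -1 / 2, 1, 1, by simp; positivity, ?_, fun θ hθ t => ?_⟩
      · norm_num [abs_of_pos]
      · simp only [Task.loss, Task.lo, Task.hi] at *
        have h1 : |(θ + 1) / 2 - Set.indicator {(-1 : ℝ)} (fun _ => (1 : ℝ)) (-1)| =
            1 / 2 + -1 / 2 * θ := by
          rw [Set.indicator_of_mem (by simp), abs_of_nonpos (by linarith [hθ.2])]; ring
        have h2 : 0 ≤ 1 / 2 + -1 / 2 * θ := by linarith [hθ.2]
        rw [h1, mul_max_of_nonneg _ _ h2]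
        ring_nf
    · refine ⟨0, 0, 0, 0, 1 / 2, 1 / 2, 1, -1, by simp; positivity, ?_, fun θ hθ t => ?_⟩
      · norm_num [abs_of_pos]
      · simp only [Task.loss, Task.lo, Task.hi] at *
        have h1 : |(θ + 1) / 2 - Set.indicator {(-1 : ℝ)} (fun _ => (1 : ℝ)) 1| =
            1 / 2 + 1 / 2 * θ := by
          rw [Set.indicator_of_notMem (by norm_num), abs_of_nonneg (by linarith [hθ.1])]; ring
        have h2 : 0 ≤ 1 / 2 + 1 / 2 * θ := by linarith [hθ.1]
        rw [h1, mul_max_of_nonneg _ _ h2]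
        ring_nf

theorem abs_le_one_of_mem (hθ : θ ∈ Set.Icc τ.lo τ.hi) : |θ| ≤ 1 := by
  cases τ <;> simp only [Task.lo, Task.hi] at hθ <;> rw [abs_le] <;>
    constructor <;> linarith [hθ.1, hθ.2]

theorem abs_loss_sub_le (hy : y ∈ τ.outputs B) (hθ : θ ∈ Set.Icc τ.lo τ.hi) (s t : ℝ) :
    |τ.loss θ y s - τ.loss θ y t| ≤ |s - t| := by
  cases τ
  · simp only [Task.loss, Task.lo, Task.hi] at *
    refine (abs_max_sub_max_le_max _ _ _ _).trans (max_le ?_ ?_)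
    · rw [← mul_sub, abs_mul, abs_of_nonneg hθ.1, show y - s - (y - t) = -(s - t) by ring, abs_neg]
      exact mul_le_of_le_one_left (abs_nonneg _) hθ.2
    · rw [← mul_sub, abs_mul, abs_of_nonpos (by linarith [hθ.2]),
        show y - s - (y - t) = -(s - t) by ring, abs_neg]
      exact mul_le_of_le_one_left (abs_nonneg _) (by linarith [hθ.1])
  · simp only [Task.loss, Task.lo, Task.hi] at *
    have hy1 : |y| = 1 := by rcases hy with rfl | rfl <;> simp
    have hw : |(θ + 1) / 2 - Set.indicator {(-1 : ℝ)} (fun _ => (1 : ℝ)) y| ≤ 1 := by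
      rw [abs_le]
      by_cases h : y ∈ ({(-1 : ℝ)} : Set ℝ)
      · rw [Set.indicator_of_mem h]; constructor <;> linarith [hθ.1, hθ.2]
      · rw [Set.indicator_of_notMem h]; constructor <;> linarith [hθ.1, hθ.2]
    rw [← mul_sub, abs_mul, abs_abs]
    refine (mul_le_of_le_one_left (abs_nonneg _) hw).trans ((abs_max_zero_sub_le _ _).trans ?_)
    rw [show 1 - y * s - (1 - y * t) = -(y * (s - t)) by ring, abs_neg, abs_mul, hy1, one_mul]

theorem loss_zero_le (hy : y ∈ τ.outputs B) (hθ : θ ∈ Set.Icc τ.lo τ.hi) :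
    τ.loss θ y 0 ≤ |B| + 1 := by
  have hB := abs_nonneg B
  cases τ
  · simp only [Task.loss, Task.lo, Task.hi] at *
    have hyB : |y| ≤ |B| := (abs_le.2 hy).trans (le_abs_self B)
    have h1 := neg_le_of_abs_le hyB
    have h2 := le_of_abs_le hyB
    exact max_le (by nlinarith [hθ.1, hθ.2]) (by nlinarith [hθ.1, hθ.2])
  · simp only [Task.loss, Task.lo, Task.hi] at *
    have hw : |(θ + 1) / 2 - Set.indicator {(-1 : ℝ)} (fun _ => (1 : ℝ)) y| ≤ 1 := by
      rw [abs_le]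
      by_cases h : y ∈ ({(-1 : ℝ)} : Set ℝ)
      · rw [Set.indicator_of_mem h]; constructor <;> linarith [hθ.1, hθ.2]
      · rw [Set.indicator_of_notMem h]; constructor <;> linarith [hθ.1, hθ.2]
    simp only [mul_zero, sub_zero, zero_le_one, max_eq_left, mul_one]
    linarith

theorem loss_le (hy : y ∈ τ.outputs B) (hθ : θ ∈ Set.Icc τ.lo τ.hi) :
    τ.loss θ y t ≤ |B| + 1 + |t| := by
  have h1 := le_of_abs_le (abs_loss_sub_le hy hθ t 0)
  rw [sub_zero] at h1
  linarith [loss_zero_le hy hθ]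

/-- A product of an affine function and of an affine function of a Lipschitz function. -/
theorem abs_affine_mul_sub_le {α β c d b F L r r' : ℝ} (hα : |α| ≤ 1) (hβ : |β| ≤ 1)
    (hc : |c| ≤ b) (hd : |d| ≤ 1) (hr : |r| ≤ 1) (ht : |t| ≤ F) (hL : |s - t| ≤ L * |r - r'|) :
    |(α + β * r) * (c + d * s) - (α + β * r') * (c + d * t)| ≤ (2 * L + b + F) * |r - r'| := by
  have e : (α + β * r) * (c + d * s) - (α + β * r') * (c + d * t) =
      (α + β * r) * d * (s - t) + β * (c + d * t) * (r - r') := by ring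
  have h1 : |α + β * r| ≤ 2 := (abs_add_le _ _).trans (by
    rw [abs_mul]; nlinarith [abs_nonneg β, abs_nonneg r])
  have h2 : |c + d * t| ≤ b + F := (abs_add_le _ _).trans (by
    rw [abs_mul]; nlinarith [abs_nonneg d, abs_nonneg t])
  rw [e]
  refine (abs_add_le _ _).trans ?_
  rw [abs_mul, abs_mul, abs_mul, abs_mul]
  have h3 : |α + β * r| * |d| * |s - t| ≤ 2 * 1 * (L * |r - r'|) := by gcongr
  have h4 : |β| * |c + d * t| * |r - r'| ≤ 1 * (b + F) * |r - r'| := by gcongr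
  linarith

theorem abs_loss_comp_sub_le {F L : ℝ} (hy : y ∈ τ.outputs B) (hθ : θ ∈ Set.Icc τ.lo τ.hi)
    (hθ' : θ' ∈ Set.Icc τ.lo τ.hi) (ht : |t| ≤ F) (hL : |s - t| ≤ L * |θ - θ'|) :
    |τ.loss θ y s - τ.loss θ' y t| ≤ 2 * (2 * L + (|B| + 1) + F) * |θ - θ'| := by
  obtain ⟨α₁, β₁, c₁, d₁, α₂, β₂, c₂, d₂, h₁, h₂, h⟩ := exists_loss_eq hy
  rw [h θ hθ, h θ' hθ']
  have e1 := abs_affine_mul_sub_le h₁.1 h₁.2.1 h₁.2.2.1 h₁.2.2.2 (abs_le_one_of_mem hθ) ht hL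
  have e2 := abs_affine_mul_sub_le h₂.1 h₂.2.1 h₂.2.2.1 h₂.2.2.2 (abs_le_one_of_mem hθ) ht hL
  rw [add_sub_add_comm]
  refine (abs_add_le _ _).trans ((add_le_add e1 ((abs_max_zero_sub_le _ _).trans e2)).trans ?_)
  linarith

end Loss

section KernelSlopes

/-- Difference quotients in the first variable of a `C¹` kernel on a square. -/
theorem exists_slope_bounds {k : ℝ → ℝ → ℝ} {lo hi : ℝ} (hlh : lo < hi)
    (hk : ContDiffOn ℝ 1 (Function.uncurry k) (Set.Icc lo hi ×ˢ Set.Icc lo hi)) :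
    (∃ K, 0 ≤ K ∧ ∀ θ ∈ Set.Icc lo hi, ∀ s ∈ Set.Icc lo hi, ∀ t ∈ Set.Icc lo hi,
      |k s θ - k t θ| ≤ K * |s - t|) ∧
    ∀ ε > 0, ∃ η > 0, ∀ a ∈ Set.Icc lo hi, ∀ b ∈ Set.Icc lo hi, a < b → b - a ≤ η →
      ∀ θ ∈ Set.Icc lo hi, ∀ s ∈ Set.Icc a b, ∀ t ∈ Set.Icc a b,
        |k s θ - k t θ - (s - t) / (b - a) * (k b θ - k a θ)| ≤ ε * |s - t| := by
  set I := Set.Icc lo hi with hI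
  have hu : UniqueDiffOn ℝ (I ×ˢ I) := (uniqueDiffOn_Icc hlh).prod (uniqueDiffOn_Icc hlh)
  set φ : ℝ × ℝ → ℝ := fun p => fderivWithin ℝ (Function.uncurry k) (I ×ˢ I) p (1, 0) with hφ
  have hφc : ContinuousOn φ (I ×ˢ I) :=
    (hk.continuousOn_fderivWithin hu le_rfl).clm_apply continuousOn_const
  have hcomp : IsCompact (I ×ˢ I) := isCompact_Icc.prod isCompact_Icc
  have hder : ∀ θ ∈ I, ∀ s ∈ I, HasDerivWithinAt (fun r => k r θ) (φ (s, θ)) I s :=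
    fun θ hθ s hs => by
      have h1 := (hk.differentiableOn one_ne_zero (s, θ) (Set.mk_mem_prod hs hθ)).hasFDerivWithinAt
      have h2 : HasDerivWithinAt (fun r : ℝ => (r, θ)) ((1 : ℝ), (0 : ℝ)) I s :=
        (hasDerivWithinAt_id s I).prodMk (hasDerivWithinAt_const s I θ)
      exact h1.comp_hasDerivWithinAt s h2 (fun r hr => Set.mk_mem_prod hr hθ)
  constructor
  · obtain ⟨K, hK⟩ := hcomp.exists_bound_of_continuousOn hφc
    have hlo : lo ∈ I := ⟨le_rfl, hlh.le⟩
    refine ⟨K, (norm_nonneg _).trans (hK (lo, lo) ⟨hlo, hlo⟩), fun θ hθ s hs t ht => ?_⟩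
    exact (convex_Icc lo hi).norm_image_sub_le_of_norm_hasDerivWithin_le
      (f := fun r => k r θ) (fun r hr => hder θ hθ r hr) (fun r hr => hK (r, θ) ⟨hr, hθ⟩) ht hs
  · intro ε hε
    obtain ⟨η, hη, hunif⟩ := Metric.uniformContinuousOn_iff.1
      (hcomp.uniformContinuousOn_of_continuous hφc) (ε / 2) (half_pos hε)
    refine ⟨η / 2, half_pos hη, fun a ha b hb hab hle θ hθ => ?_⟩
    have hsub : Set.Icc a b ⊆ I := Set.Icc_subset_Icc ha.1 hb.2
    have key : ∀ s ∈ Set.Icc a b, ∀ t ∈ Set.Icc a b,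
        |k s θ - k t θ - φ (a, θ) * (s - t)| ≤ ε / 2 * |s - t| := fun s hs t ht => by
      have h1 := (convex_Icc a b).norm_image_sub_le_of_norm_hasDerivWithin_le
        (f := fun r => k r θ - φ (a, θ) * r) (f' := fun r => φ (r, θ) - φ (a, θ) * 1) (C := ε / 2)
        (fun r hr => ((hder θ hθ r (hsub hr)).mono hsub).sub
          ((hasDerivWithinAt_id r _).const_mul _))
        (fun r hr => by
          have h2 := hunif (r, θ) ⟨hsub hr, hθ⟩ (a, θ) ⟨ha, hθ⟩ (by
            rw [Prod.dist_eq, dist_self, Real.dist_eq, abs_of_nonneg (by linarith [hr.1])]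
            exact max_lt (by linarith [hr.2]) hη)
          rw [mul_one]
          exact h2.le) ht hs
      rw [Real.norm_eq_abs, Real.norm_eq_abs] at h1
      refine le_trans (le_of_eq ?_) h1
      congr 1; ring
    intro s hs t ht
    have h1 := key s hs t ht
    have h2 := key b ⟨hab.le, le_rfl⟩ a ⟨le_rfl, hab.le⟩
    have hpos : 0 < b - a := sub_pos.2 hab
    rw [abs_of_pos hpos] at h2
    have e : k s θ - k t θ - (s - t) / (b - a) * (k b θ - k a θ) =
        (k s θ - k t θ - φ (a, θ) * (s - t)) -
          (s - t) / (b - a) * (k b θ - k a θ - φ (a, θ) * (b - a)) := by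
      field_simp; ring
    rw [e]
    refine (abs_sub _ _).trans ?_
    rw [abs_mul, abs_div, abs_of_pos hpos]
    have h3 : |s - t| / (b - a) * |k b θ - k a θ - φ (a, θ) * (b - a)| ≤
        |s - t| / (b - a) * (ε / 2 * (b - a)) :=
      mul_le_mul_of_nonneg_left h2 (by positivity)
    have h4 : |s - t| / (b - a) * (ε / 2 * (b - a)) = ε / 2 * |s - t| := by field_simp
    linarith

end KernelSlopes

section Quadrature

variable {τ : Task} {HΘ : Type*} [NormedAddCommGroup HΘ] [InnerProductSpace ℝ HΘ]
  [RKHS ℝ HΘ τ.Hyper ℝ]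

theorem Task.hi_sub_lo_le (τ : Task) : τ.hi - τ.lo ≤ 2 := by
  cases τ <;> norm_num [Task.lo, Task.hi]

theorem integratedLoss_le_of_sum_le (μ : Measure τ.Hyper) [IsProbabilityMeasure μ] {m : ℕ}
    (hm : 1 ≤ m) {y C : ℝ} {f : HΘ} (hc : Continuous fun θ : τ.Hyper => τ.loss θ y (f θ))
    (h : |∑ j ∈ Finset.range m, τ.loss (quantile τ μ (sobol j)) y (f (quantile τ μ (sobol j))) -
      m * ∫ u in (0 : ℝ)..1, τ.loss (quantile τ μ u) y (f (quantile τ μ u))| ≤ C) :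
    integratedLoss τ μ y f ≤ sampledLoss τ μ m y f + C / m := by
  have hm' : (0 : ℝ) < m := by exact_mod_cast hm
  unfold integratedLoss sampledLoss node
  rw [integral_comp_quantile μ hc]
  have h1 := neg_le_of_abs_le h
  rw [one_div, inv_mul_eq_div, ← add_div, le_div_iff₀ hm']
  linarith

theorem continuous_of_lipschitz {g : τ.Hyper → ℝ} {L : ℝ}
    (hg : ∀ s t : τ.Hyper, |g s - g t| ≤ L * |(s : ℝ) - t|) : Continuous g := by
  refine (LipschitzWith.of_dist_le_mul (K := L.toNNReal) fun s t => ?_).continuous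
  rw [Real.dist_eq, Subtype.dist_eq, Real.dist_eq]
  exact (hg s t).trans (mul_le_mul_of_nonneg_right (Real.le_coe_toNNReal L) (abs_nonneg _))

theorem abs_gridSum_loss_sub_le (μ : Measure τ.Hyper) [IsProbabilityMeasure μ] {y B F L : ℝ}
    {f : HΘ} (hy : y ∈ τ.outputs B) (hL : 0 ≤ L) (hF : ∀ θ : τ.Hyper, |f θ| ≤ F)
    (hf : ∀ s t : τ.Hyper, |f s - f t| ≤ L * |(s : ℝ) - t|) (k : ℕ) {x x' : ℝ}
    (hx : x ∈ Set.Ico (0 : ℝ) 1) (hx' : x' ∈ Set.Ico (0 : ℝ) 1) :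
    |gridSum k (fun u => τ.loss (quantile τ μ u) y (f (quantile τ μ u))) x -
      gridSum k (fun u => τ.loss (quantile τ μ u) y (f (quantile τ μ u))) x'| ≤
        4 * (2 * L + (|B| + 1) + F) := by
  have hF0 : 0 ≤ F := (abs_nonneg _).trans (hF ⟨τ.lo, le_rfl, τ.lo_le_hi⟩)
  have hmono : MonotoneOn (fun u => (quantile τ μ u : ℝ)) (Set.Icc 0 1) :=
    fun u hu u' hu' h => quantile_monotoneOn μ hu.2 hu'.2 h
  have h := abs_gridSum_sub_le_of_monotoneOn (Q := fun u => (quantile τ μ u : ℝ))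
    (G := fun u => τ.loss (quantile τ μ u) y (f (quantile τ μ u)))
    (L := 2 * (2 * L + (|B| + 1) + F)) (ℓ := 2)
    (α := τ.lo) (by positivity) hmono (quantile τ μ 0).2.1
    (by linarith [(quantile τ μ 1).2.2, τ.hi_sub_lo_le])
    (fun u _ u' _ => abs_loss_comp_sub_le hy (quantile τ μ u).2 (quantile τ μ u').2 (hF _) (hf _ _))
    k ⟨hx.1, hx.2.le⟩ ⟨hx'.1, hx'.2.le⟩
  linarith

theorem continuous_loss_comp {y B F L : ℝ} {f : HΘ} (hy : y ∈ τ.outputs B)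
    (hF : ∀ θ : τ.Hyper, |f θ| ≤ F) (hf : ∀ s t : τ.Hyper, |f s - f t| ≤ L * |(s : ℝ) - t|) :
    Continuous fun θ : τ.Hyper => τ.loss θ y (f θ) :=
  continuous_of_lipschitz fun s t => abs_loss_comp_sub_le hy s.2 t.2 (hF t) (hf s t)

/-- Quasi-Monte Carlo error for a Lipschitz integrand and any measure. -/
theorem integratedLoss_le_of_lipschitz (μ : Measure τ.Hyper) [IsProbabilityMeasure μ] {m : ℕ}
    (hm : 2 ≤ m) {y B F L : ℝ} {f : HΘ} (hy : y ∈ τ.outputs B) (hL : 0 ≤ L)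
    (hF : ∀ θ : τ.Hyper, |f θ| ≤ F) (hf : ∀ s t : τ.Hyper, |f s - f t| ≤ L * |(s : ℝ) - t|) :
    integratedLoss τ μ y f ≤ sampledLoss τ μ m y f +
      12 * (2 * L + (|B| + 1) + F) * (Real.log m / m) := by
  have hF0 : 0 ≤ F := (abs_nonneg _).trans (hF ⟨τ.lo, le_rfl, τ.lo_le_hi⟩)
  have hc := continuous_loss_comp hy hF hf
  have hN := abs_sum_sobol_sub_le (Nat.log 2 m + 1) _ (intervalIntegrable_comp_quantile μ hc)
    (fun _ => 4 * (2 * L + (|B| + 1) + F))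
    (fun k x hx x' hx' => abs_gridSum_loss_sub_le μ hy hL hF hf k hx hx') m
    (Nat.lt_pow_succ_log_self one_lt_two m)
  rw [Finset.sum_const, Finset.card_range, nsmul_eq_mul] at hN
  have hK : 0 ≤ 4 * (2 * L + (|B| + 1) + F) := by positivity
  have h1 := integratedLoss_le_of_sum_le μ (by omega) hc
    (hN.trans (mul_le_mul_of_nonneg_right (natLog_two_add_one_le hm) hK))
  refine h1.trans (le_of_eq ?_)
  ring

theorem abs_affine_mul_sub_slope_le {α β c d r r' r₀ v v' v₀ p ℓ ε η L x : ℝ} (hα : |α| ≤ 1)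
    (hβ : |β| ≤ 1) (hd : |d| ≤ 1) (hr : |r| ≤ 1) (hrr : r - r' = ℓ * x) (hℓ : 0 ≤ ℓ) (hℓ2 : ℓ ≤ 2)
    (hr₀ : |r - r₀| ≤ 2 * η) (hv : |v - v' - p * x| ≤ ε * |x|) (hv₀ : |v' - v₀| ≤ L * η)
    (hp : |p| ≤ L) :
    |(α + β * r) * (c + d * v) - (α + β * r') * (c + d * v') -
      ((α + β * r₀) * d * p + β * ℓ * (c + d * v₀)) * x| ≤ (2 * ε + 4 * (L * η)) * |x| := by
  have e : (α + β * r) * (c + d * v) - (α + β * r') * (c + d * v') -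
      ((α + β * r₀) * d * p + β * ℓ * (c + d * v₀)) * x =
      (α + β * r) * d * (v - v' - p * x) + β * d * (r - r₀) * p * x +
        β * d * ℓ * (v' - v₀) * x := by
    linear_combination (β * (c + d * v')) * hrr
  have h1 : |α + β * r| ≤ 2 := (abs_add_le _ _).trans (by
    rw [abs_mul]; nlinarith [abs_nonneg β, abs_nonneg r])
  have hη : 0 ≤ η := by linarith [abs_nonneg (r - r₀)]
  have hL : 0 ≤ L := (abs_nonneg p).trans hp
  rw [e]
  refine (abs_add_three _ _ _).trans ?_
  simp only [abs_mul]
  rw [abs_of_nonneg hℓ]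
  have t1 : |α + β * r| * |d| * |v - v' - p * x| ≤ 2 * 1 * (ε * |x|) := by gcongr
  have t2 : |β| * |d| * |r - r₀| * |p| * |x| ≤ 1 * 1 * (2 * η) * L * |x| := by gcongr
  have t3 : |β| * |d| * ℓ * |v' - v₀| * |x| ≤ 1 * 1 * 2 * (L * η) * |x| := by gcongr
  linarith

theorem sum_range_ite_lt_le (N k : ℕ) {c : ℝ} (hc : 0 ≤ c) :
    ∑ i ∈ Finset.range N, (if i < k then c else 0) ≤ k * c := by
  rw [← Finset.sum_filter, Finset.sum_const, nsmul_eq_mul]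
  refine mul_le_mul_of_nonneg_right ?_ hc
  have : (Finset.range N).filter (· < k) ⊆ Finset.range k := fun i hi => by
    simpa using (Finset.mem_filter.1 hi).2
  simpa using Finset.card_le_card this

theorem abs_comp_sub_slope_le {kΘ : ℝ → ℝ → ℝ} {f : HΘ} {Q : ℝ → τ.Hyper}
    {ℓ A ε η δ u₀ u u' : ℝ} (hℓ : 0 < ℓ) (hδ : 0 < δ) (hδη : ℓ * δ ≤ η)
    (hQ : ∀ v ∈ Set.Icc u₀ (u₀ + δ), ∀ v' ∈ Set.Icc u₀ (u₀ + δ),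
      (Q v : ℝ) - Q v' = ℓ * (v - v'))
    (hslope : ∀ a ∈ Set.Icc τ.lo τ.hi, ∀ b ∈ Set.Icc τ.lo τ.hi, a < b → b - a ≤ η →
      ∀ θ ∈ Set.Icc τ.lo τ.hi, ∀ s ∈ Set.Icc a b, ∀ t ∈ Set.Icc a b,
        |kΘ s θ - kΘ t θ - (s - t) / (b - a) * (kΘ b θ - kΘ a θ)| ≤ ε * |s - t|)
    (hf : ∀ (s t a b : τ.Hyper) (c W : ℝ),
      (∀ θ : τ.Hyper, |kΘ s θ - kΘ t θ - c * (kΘ b θ - kΘ a θ)| ≤ W) →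
      |f s - f t - c * (f b - f a)| ≤ A * W)
    (hu : u ∈ Set.Icc u₀ (u₀ + δ)) (hu' : u' ∈ Set.Icc u₀ (u₀ + δ)) :
    |f (Q u) - f (Q u') - (f (Q (u₀ + δ)) - f (Q u₀)) / δ * (u - u')| ≤
      A * (ε * ℓ) * |u - u'| := by
  have m0 : u₀ ∈ Set.Icc u₀ (u₀ + δ) := ⟨le_rfl, by linarith⟩
  have m1 : u₀ + δ ∈ Set.Icc u₀ (u₀ + δ) := ⟨by linarith, le_rfl⟩
  have hba : (Q (u₀ + δ) : ℝ) - Q u₀ = ℓ * δ := by rw [hQ _ m1 _ m0, add_sub_cancel_left]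
  have hpos : 0 < ℓ * δ := mul_pos hℓ hδ
  have hmem : ∀ v ∈ Set.Icc u₀ (u₀ + δ), (Q v : ℝ) ∈ Set.Icc (Q u₀ : ℝ) (Q (u₀ + δ)) :=
    fun v hv => by
      have h1 := hQ v hv u₀ m0
      have h2 := hQ (u₀ + δ) m1 v hv
      have h3 : 0 ≤ ℓ * (v - u₀) := mul_nonneg hℓ.le (by linarith [hv.1])
      have h4 : 0 ≤ ℓ * (u₀ + δ - v) := mul_nonneg hℓ.le (by linarith [hv.2])
      exact ⟨by linarith, by linarith⟩
  have h := hf (Q u) (Q u') (Q u₀) (Q (u₀ + δ)) ((u - u') / δ) (ε * (ℓ * |u - u'|)) fun θ => by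
    have hs := hslope (Q u₀) (Q u₀).2 (Q (u₀ + δ)) (Q (u₀ + δ)).2
      (by linarith) (by rw [hba]; exact hδη) θ θ.2 (Q u) (hmem u hu) (Q u') (hmem u' hu')
    rwa [hba, hQ _ hu _ hu', mul_div_mul_left _ _ hℓ.ne', abs_mul, abs_of_pos hℓ] at hs
  calc _ = |f (Q u) - f (Q u') - (u - u') / δ * (f (Q (u₀ + δ)) - f (Q u₀))| := by
        congr 1; ring
    _ ≤ _ := h
    _ = _ := by ring

section Kernel

variable [CompleteSpace HΘ] {kΘ : ℝ → ℝ → ℝ}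

theorem inner_kerFun_one (f : HΘ) (θ : τ.Hyper) :
    inner ℝ f (RKHS.kerFun HΘ θ (1 : ℝ)) = f θ := by
  simp

theorem kerFun_one_apply
    (hΘ : ∀ s t : τ.Hyper, RKHS.kernel HΘ s t = kΘ s t • ContinuousLinearMap.id ℝ ℝ)
    (s t : τ.Hyper) : RKHS.kerFun HΘ t (1 : ℝ) s = kΘ s t := by
  rw [RKHS.kerFun_apply, hΘ]; simp

theorem kernel_symm
    (hΘ : ∀ s t : τ.Hyper, RKHS.kernel HΘ s t = kΘ s t • ContinuousLinearMap.id ℝ ℝ)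
    (s t : τ.Hyper) : kΘ s t = kΘ t s := by
  rw [← kerFun_one_apply hΘ, ← kerFun_one_apply hΘ, ← inner_kerFun_one, ← inner_kerFun_one,
    real_inner_comm]

/-- Functions of the RKHS that are dominated by the supremum norm inherit the smoothness of the
kernel. -/
theorem slope_bounds_of_dual
    (hΘ : ∀ s t : τ.Hyper, RKHS.kernel HΘ s t = kΘ s t • ContinuousLinearMap.id ℝ ℝ)
    {f : HΘ} {A : ℝ}
    (hf : ∀ (w : HΘ) (W : ℝ), (∀ θ : τ.Hyper, |w θ| ≤ W) → |inner ℝ f w| ≤ A * W) :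
    (∀ (s t : τ.Hyper) (W : ℝ), (∀ θ : τ.Hyper, |kΘ s θ - kΘ t θ| ≤ W) → |f s - f t| ≤ A * W) ∧
    ∀ (s t a b : τ.Hyper) (c W : ℝ),
      (∀ θ : τ.Hyper, |kΘ s θ - kΘ t θ - c * (kΘ b θ - kΘ a θ)| ≤ W) →
      |f s - f t - c * (f b - f a)| ≤ A * W := by
  have hw : ∀ s θ : τ.Hyper, RKHS.kerFun HΘ s (1 : ℝ) θ = kΘ s θ := fun s θ => by
    rw [kerFun_one_apply hΘ, kernel_symm hΘ]
  constructor
  · intro s t W h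
    have := hf (RKHS.kerFun HΘ s (1 : ℝ) - RKHS.kerFun HΘ t (1 : ℝ)) W fun θ => by
      rw [RKHS.coe_sub, Pi.sub_apply, hw, hw]; exact h θ
    rwa [inner_sub_right, inner_kerFun_one, inner_kerFun_one] at this
  · intro s t a b c W h
    have := hf (RKHS.kerFun HΘ s (1 : ℝ) - RKHS.kerFun HΘ t (1 : ℝ) -
      c • (RKHS.kerFun HΘ b (1 : ℝ) - RKHS.kerFun HΘ a (1 : ℝ))) W fun θ => by
      rw [RKHS.coe_sub, RKHS.coe_sub, RKHS.coe_smul, RKHS.coe_sub]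
      simp only [Pi.sub_apply, Pi.smul_apply, hw, smul_eq_mul]
      exact h θ
    rwa [inner_sub_right, inner_sub_right, real_inner_smul_right, inner_sub_right, inner_kerFun_one,
      inner_kerFun_one, inner_kerFun_one, inner_kerFun_one] at this

/-- Grid sums at fine scales, for the uniform measure. -/
theorem exists_gridSum_loss_uniform_le
    (hΘ : ∀ s t : τ.Hyper, RKHS.kernel HΘ s t = kΘ s t • ContinuousLinearMap.id ℝ ℝ)
    (hk : ContDiffOn ℝ 1 (Function.uncurry kΘ) (Set.Icc τ.lo τ.hi ×ˢ Set.Icc τ.lo τ.hi))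
    (B : ℝ) {A F : ℝ} (hA : 0 ≤ A) (hF0 : 0 ≤ F) :
    ∃ (K : ℝ) (k₁ : ℕ), 0 ≤ K ∧ ∀ f : HΘ, (∀ θ : τ.Hyper, |f θ| ≤ F) →
      (∀ (w : HΘ) (W : ℝ), (∀ θ : τ.Hyper, |w θ| ≤ W) → |inner ℝ f w| ≤ A * W) →
      (∀ s t : τ.Hyper, |f s - f t| ≤ K * |(s : ℝ) - t|) ∧
      ∀ y ∈ τ.outputs B, ∀ k ≥ k₁, ∀ x ∈ Set.Ico (0 : ℝ) 1, ∀ x' ∈ Set.Ico (0 : ℝ) 1,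
        |gridSum k (fun u => τ.loss (quantile τ τ.uniform u) y (f (quantile τ τ.uniform u))) x -
          gridSum k (fun u => τ.loss (quantile τ τ.uniform u) y (f (quantile τ τ.uniform u))) x'| ≤
            |B| + 1 + F + 1 := by
  obtain ⟨⟨K₁, hK₁, hlip⟩, hslope⟩ := exists_slope_bounds τ.lo_lt_hi hk
  set ℓ := τ.hi - τ.lo with hℓdef
  have hℓ : 0 < ℓ := sub_pos.2 τ.lo_lt_hi
  have hℓ2 : ℓ ≤ 2 := τ.hi_sub_lo_le
  obtain ⟨η, hη, hslope⟩ := hslope (1 / (96 * (A + 1))) (by positivity)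
  set K := A * K₁ with hKdef
  have hK : 0 ≤ K := by positivity
  set L := 2 * K with hLdef
  have hL : 0 ≤ L := by positivity
  set Lb := 2 * (2 * K + (|B| + 1) + F) with hLbdef
  have hLb : 0 ≤ Lb := by positivity
  obtain ⟨k₀, hk₀⟩ := exists_pow_lt_of_lt_one
    (show 0 < min (η / 2) (1 / (96 * (L + 1))) by positivity) (show (1 / 2 : ℝ) < 1 by norm_num)
  obtain ⟨r₀, hr₀⟩ := exists_pow_lt_of_lt_one
    (show 0 < 1 / (4 * (Lb + 1)) by positivity) (show (1 / 2 : ℝ) < 1 by norm_num)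
  set δ : ℝ := (1 / 2 : ℝ) ^ k₀ with hδdef
  have hδ : 0 < δ := by positivity
  have hδη : 2 * δ ≤ η := by linarith [hk₀.trans_le (min_le_left _ _)]
  have hδL : L * δ ≤ 1 / 96 := by
    have h1 := hk₀.trans_le (min_le_right _ _)
    rw [lt_div_iff₀ (by positivity)] at h1
    nlinarith
  refine ⟨K, k₀ + r₀, hK, fun f hF hf => ?_⟩
  obtain ⟨hd1, hd2⟩ := slope_bounds_of_dual hΘ hf
  have hfl : ∀ s t : τ.Hyper, |f s - f t| ≤ K * |(s : ℝ) - t| := fun s t => by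
    rw [hKdef, mul_assoc]
    exact hd1 s t _ fun θ => hlip θ θ.2 s s.2 t t.2
  refine ⟨hfl, fun y hy k hkk x hx x' hx' => ?_⟩
  obtain ⟨α₁, β₁, c₁, d₁, α₂, β₂, c₂, d₂, h₁, h₂, hloss⟩ := exists_loss_eq hy
  set Q := quantile τ τ.uniform with hQ
  have hQc : ∀ u ∈ Set.Icc (0 : ℝ) 1, (Q u : ℝ) = τ.lo + ℓ * u := fun u hu =>
    coe_quantile_uniform τ hu
  have hQd : ∀ u ∈ Set.Icc (0 : ℝ) 1, ∀ u' ∈ Set.Icc (0 : ℝ) 1,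
      (Q u : ℝ) - Q u' = ℓ * (u - u') := fun u hu u' hu' => by
    rw [hQc u hu, hQc u' hu']; ring
  have hfQ : ∀ u ∈ Set.Icc (0 : ℝ) 1, ∀ u' ∈ Set.Icc (0 : ℝ) 1,
      |f (Q u) - f (Q u')| ≤ L * |u - u'| := fun u hu u' hu' => by
    refine (hfl _ _).trans ?_
    rw [hQd u hu u' hu', abs_mul, abs_of_pos hℓ, ← mul_assoc]
    exact mul_le_mul_of_nonneg_right (by rw [hLdef]; nlinarith) (abs_nonneg _)
  set a : ℝ → ℝ := fun u => (α₁ + β₁ * Q u) * (c₁ + d₁ * f (Q u)) with ha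
  set b : ℝ → ℝ := fun u => (α₂ + β₂ * Q u) * (c₂ + d₂ * f (Q u)) with hb
  have hG : (fun u => τ.loss (Q u) y (f (Q u))) = fun u => a u + max (b u) 0 :=
    funext fun u => hloss _ (Q u).2 _
  have hbL : ∀ s ∈ Set.Icc (0 : ℝ) 1, ∀ s' ∈ Set.Icc (0 : ℝ) 1, |b s - b s'| ≤ Lb * |s - s'| :=
    fun s hs s' hs' => by
      have h := abs_affine_mul_sub_le h₂.1 h₂.2.1 h₂.2.2.1 h₂.2.2.2
        (abs_le_one_of_mem (Q s).2) (hF (Q s')) (hfl (Q s) (Q s'))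
      refine h.trans ?_
      rw [hQd s hs s' hs', abs_mul, abs_of_pos hℓ, ← mul_assoc]
      refine mul_le_mul_of_nonneg_right ?_ (abs_nonneg _)
      have : 0 ≤ 2 * K + (|B| + 1) + F := by positivity
      rw [hLbdef]; nlinarith
  have hcell : ∀ i : ℕ, i < 2 ^ k₀ → ∃ p q : ℝ,
      ∀ s ∈ Set.Icc ((i : ℝ) / 2 ^ k₀) (((i : ℝ) + 1) / 2 ^ k₀),
      ∀ s' ∈ Set.Icc ((i : ℝ) / 2 ^ k₀) (((i : ℝ) + 1) / 2 ^ k₀),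
        |a s - a s' - p * (s - s')| ≤ 1 / 12 * |s - s'| ∧
        |b s - b s' - q * (s - s')| ≤ 1 / 12 * |s - s'| := fun i hi => by
    have hu01 : ((i : ℝ) + 1) / 2 ^ k₀ = (i : ℝ) / 2 ^ k₀ + δ := by
      rw [hδdef, add_div, div_pow, one_pow]
    have hu1le : ((i : ℝ) + 1) / 2 ^ k₀ ≤ 1 := by
      rw [div_le_one (by positivity)]; exact_mod_cast hi
    rw [hu01] at hu1le ⊢
    set u₀ : ℝ := (i : ℝ) / 2 ^ k₀ with hu₀
    have hu₀0 : 0 ≤ u₀ := by positivity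
    have hsub : Set.Icc u₀ (u₀ + δ) ⊆ Set.Icc (0 : ℝ) 1 := Set.Icc_subset_Icc hu₀0 hu1le
    have m0 : u₀ ∈ Set.Icc u₀ (u₀ + δ) := ⟨le_rfl, by linarith⟩
    have m1 : u₀ + δ ∈ Set.Icc u₀ (u₀ + δ) := ⟨by linarith, le_rfl⟩
    set p : ℝ := (f (Q (u₀ + δ)) - f (Q u₀)) / δ with hp
    have hpL : |p| ≤ L := by
      rw [hp, abs_div, abs_of_pos hδ, div_le_iff₀ hδ]
      have := hfQ _ (hsub m1) _ (hsub m0)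
      rwa [add_sub_cancel_left, abs_of_pos hδ] at this
    have hnear : ∀ u ∈ Set.Icc u₀ (u₀ + δ), ∀ u' ∈ Set.Icc u₀ (u₀ + δ),
        |f (Q u) - f (Q u') - p * (u - u')| ≤ 1 / 48 * |u - u'| := fun u hu u' hu' => by
      refine (abs_comp_sub_slope_le hℓ hδ ((mul_le_mul_of_nonneg_right hℓ2 hδ.le).trans hδη)
        (fun v hv v' hv' => hQd v (hsub hv) v' (hsub hv')) hslope hd2 hu hu').trans
        (mul_le_mul_of_nonneg_right ?_ (abs_nonneg _))
      have hA1 : A * (1 / (96 * (A + 1))) ≤ 1 / 96 := by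
        rw [mul_one_div, div_le_div_iff₀ (by positivity) (by norm_num)]; linarith
      calc A * (1 / (96 * (A + 1)) * ℓ) = A * (1 / (96 * (A + 1))) * ℓ := by ring
        _ ≤ 1 / 96 * 2 := mul_le_mul hA1 hℓ2 hℓ.le (by norm_num)
        _ = 1 / 48 := by norm_num
    have hprod : ∀ {α β c d : ℝ}, |α| ≤ 1 → |β| ≤ 1 → |d| ≤ 1 →
        ∀ s ∈ Set.Icc u₀ (u₀ + δ), ∀ s' ∈ Set.Icc u₀ (u₀ + δ),
        |(α + β * Q s) * (c + d * f (Q s)) - (α + β * Q s') * (c + d * f (Q s')) -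
          ((α + β * Q u₀) * d * p + β * ℓ * (c + d * f (Q u₀))) * (s - s')| ≤
            1 / 12 * |s - s'| := fun {α β c d} hα hβ hd s hs s' hs' => by
      have habs : ∀ v ∈ Set.Icc u₀ (u₀ + δ), |v - u₀| ≤ δ := fun v hv => by
        rw [abs_of_nonneg (by linarith [hv.1])]; linarith [hv.2]
      refine (abs_affine_mul_sub_slope_le (ε := 1 / 48) (η := δ) (L := L) hα hβ hd
        (abs_le_one_of_mem (Q s).2) (hQd s (hsub hs) s' (hsub hs')) hℓ.le hℓ2 ?_
        (hnear s hs s' hs') ?_ hpL).trans ?_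
      · rw [hQd s (hsub hs) u₀ (hsub m0), abs_mul, abs_of_pos hℓ]
        exact mul_le_mul hℓ2 (habs s hs) (abs_nonneg _) (by norm_num)
      · exact (hfQ s' (hsub hs') u₀ (hsub m0)).trans
          (mul_le_mul_of_nonneg_left (habs s' hs') hL)
      · exact mul_le_mul_of_nonneg_right (by linarith) (abs_nonneg _)
    exact ⟨_, _, fun s hs s' hs' => ⟨hprod h₁.1 h₁.2.1 h₁.2.2.2 s hs s' hs',
      hprod h₂.1 h₂.2.1 h₂.2.2.2 s hs s' hs'⟩⟩
  have hmain := abs_gridSum_sub_le_of_nearly_affine (a := a) (b := b) (ε := 1 / 12) (L := Lb)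
    (k₀ := k₀) (k := k) (by norm_num) hLb (by omega) hcell hbL ⟨hx.1, hx.2.le⟩ ⟨hx'.1, hx'.2.le⟩
  rw [hG]
  refine hmain.trans ?_
  have hends : |(a 1 + max (b 1) 0) - (a 0 + max (b 0) 0)| ≤ |B| + 1 + F := by
    have e : ∀ u, a u + max (b u) 0 = τ.loss (Q u) y (f (Q u)) := fun u =>
      (congrFun hG u).symm
    rw [e, e, abs_le]
    have n0 := loss_nonneg (Q 0).2 y (f (Q 0))
    have n1 := loss_nonneg (Q 1).2 y (f (Q 1))
    have l0 := loss_le (t := f (Q 0)) hy (Q 0).2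
    have l1 := loss_le (t := f (Q 1)) hy (Q 1).2
    constructor <;> linarith [hF (Q 0), hF (Q 1)]
  have hlast : 2 * Lb * (2 ^ k₀ / 2 ^ k) ≤ 1 / 2 := by
    have h1 : (2 : ℝ) ^ k₀ / 2 ^ k ≤ (1 / 2) ^ r₀ := by
      rw [div_pow, one_pow, div_le_div_iff₀ (by positivity) (by positivity), ← pow_add, one_mul]
      exact pow_le_pow_right₀ (by norm_num) hkk
    rw [lt_div_iff₀ (by positivity)] at hr₀
    have h2 : (0 : ℝ) ≤ (1 / 2) ^ r₀ := by positivity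
    nlinarith
  linarith

/-- Quasi-Monte Carlo error for the uniform measure: the constant only depends on the size of the
integrand. -/
theorem exists_integratedLoss_uniform_le
    (hΘ : ∀ s t : τ.Hyper, RKHS.kernel HΘ s t = kΘ s t • ContinuousLinearMap.id ℝ ℝ)
    (hk : ContDiffOn ℝ 1 (Function.uncurry kΘ) (Set.Icc τ.lo τ.hi ×ˢ Set.Icc τ.lo τ.hi))
    (B : ℝ) {A F : ℝ} (hA : 0 ≤ A) (hF0 : 0 ≤ F) :
    ∃ M : ℕ, 1 ≤ M ∧ ∀ m ≥ M, ∀ f : HΘ, (∀ θ : τ.Hyper, |f θ| ≤ F) →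
      (∀ (w : HΘ) (W : ℝ), (∀ θ : τ.Hyper, |w θ| ≤ W) → |inner ℝ f w| ≤ A * W) →
      ∀ y ∈ τ.outputs B, integratedLoss τ τ.uniform y f ≤ sampledLoss τ τ.uniform m y f +
        (3 * (|B| + 1 + F) + 4) * (Real.log m / m) := by
  have := isProbabilityMeasure_uniform τ
  obtain ⟨K, k₁, hK, hgrid⟩ := exists_gridSum_loss_uniform_le hΘ hk B hA hF0
  set c := 4 * (2 * K + (|B| + 1) + F) with hc
  have hc0 : 0 ≤ c := by positivity
  obtain ⟨M, hM⟩ := exists_nat_ge (Real.exp (k₁ * c))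
  refine ⟨max M 2, le_max_of_le_right one_le_two, fun m hm f hF hf y hy => ?_⟩
  obtain ⟨hfl, hfine⟩ := hgrid f hF hf
  have hm2 : 2 ≤ m := (le_max_right _ _).trans hm
  have hm0 : (0 : ℝ) < m := by positivity
  have hlog : k₁ * c ≤ Real.log m := by
    rw [Real.le_log_iff_exp_le hm0]
    exact hM.trans (by exact_mod_cast (le_max_left _ _).trans hm)
  have hcont := continuous_loss_comp hy hF hfl
  have hN := abs_sum_sobol_sub_le (Nat.log 2 m + 1) _
    (intervalIntegrable_comp_quantile τ.uniform hcont)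
    (fun k => (if k < k₁ then c else 0) + (|B| + 1 + F + 1))
    (fun k x hx x' hx' => by
      split_ifs with h
      · have := abs_gridSum_loss_sub_le τ.uniform hy hK hF hfl k hx hx'
        have : 0 ≤ |B| + 1 + F + 1 := by positivity
        linarith
      · rw [zero_add]
        exact hfine y hy k (not_lt.1 h) x hx x' hx') m
    (Nat.lt_pow_succ_log_self one_lt_two m)
  rw [Finset.sum_add_distrib, Finset.sum_const, Finset.card_range, nsmul_eq_mul] at hN
  have h1 := natLog_two_add_one_le hm2
  have h2 : ((Nat.log 2 m + 1 : ℕ) : ℝ) * (|B| + 1 + F + 1) ≤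
      3 * Real.log m * (|B| + 1 + F + 1) := mul_le_mul_of_nonneg_right h1 (by positivity)
  have h3 := sum_range_ite_lt_le (Nat.log 2 m + 1) k₁ hc0
  have h4 := integratedLoss_le_of_sum_le τ.uniform (by omega) hcont
    (C := (3 * (|B| + 1 + F) + 4) * Real.log m) (hN.trans (by linarith))
  rwa [mul_div_assoc] at h4

end Kernel

end Quadrature

section Hypotheses

variable {𝒳 HΘ H : Type*} {τ : Task}
  [NormedAddCommGroup HΘ] [InnerProductSpace ℝ HΘ] [RKHS ℝ HΘ τ.Hyper ℝ]
  [NormedAddCommGroup H] [InnerProductSpace ℝ H] [RKHS ℝ H 𝒳 HΘ]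

theorem one_div_mul_sum_le {ι : Type*} (s : Finset ι) (f : ι → ℝ) {C : ℝ} (hC : 0 ≤ C)
    (hf : ∀ i ∈ s, f i ≤ C) : (1 / s.card : ℝ) * ∑ i ∈ s, f i ≤ C := by
  rcases Nat.eq_zero_or_pos s.card with h | h
  · simpa [h] using hC
  · have h' : (0 : ℝ) < s.card := by exact_mod_cast h
    rw [one_div, inv_mul_eq_div, div_le_iff₀ h', mul_comm]
    simpa using Finset.sum_le_card_nsmul s f C hf

theorem integratedLoss_nonneg (μ : Measure τ.Hyper) (y : ℝ) (f : HΘ) :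
    0 ≤ integratedLoss τ μ y f :=
  integral_nonneg fun θ => loss_nonneg θ.2 _ _

theorem sampledLoss_nonneg (μ : Measure τ.Hyper) (m : ℕ) (y : ℝ) (f : HΘ) :
    0 ≤ sampledLoss τ μ m y f :=
  mul_nonneg (by positivity) (Finset.sum_nonneg fun j _ => loss_nonneg (node τ μ j).2 _ _)

theorem sampledEmpiricalRisk_nonneg (μ : Measure τ.Hyper) (m : ℕ) {n : ℕ} (S : Fin n → 𝒳 × ℝ)
    (h : H) : 0 ≤ sampledEmpiricalRisk τ μ m S h :=
  mul_nonneg (by positivity) (Finset.sum_nonneg fun i _ => sampledLoss_nonneg μ m _ _)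

theorem sampledEmpiricalRisk_midpoint_le (μ : Measure τ.Hyper) (m : ℕ) {n : ℕ}
    (S : Fin n → 𝒳 × ℝ) (g h : H) : sampledEmpiricalRisk τ μ m S ((1 / 2 : ℝ) • (g + h)) ≤
      (sampledEmpiricalRisk τ μ m S g + sampledEmpiricalRisk τ μ m S h) / 2 := by
  unfold sampledEmpiricalRisk sampledLoss
  rw [← mul_add, mul_div_assoc, ← Finset.sum_add_distrib, Finset.sum_div]
  refine mul_le_mul_of_nonneg_left (Finset.sum_le_sum fun i _ => ?_) (by positivity)
  rw [← mul_add, mul_div_assoc, ← Finset.sum_add_distrib, Finset.sum_div]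
  refine mul_le_mul_of_nonneg_left (Finset.sum_le_sum fun j _ => ?_) (by positivity)
  refine le_trans (le_of_eq ?_) (loss_midpoint_le _ _ _ _)
  congr 1
  simp only [RKHS.coe_smul, RKHS.coe_add, Pi.smul_apply, Pi.add_apply, smul_eq_mul]
  ring

theorem continuous_sampledEmpiricalRisk (μ : Measure τ.Hyper) (m : ℕ) {n : ℕ}
    (S : Fin n → 𝒳 × ℝ) : Continuous fun h : H => sampledEmpiricalRisk τ μ m S h := by
  unfold sampledEmpiricalRisk sampledLoss
  refine continuous_const.mul (continuous_finsetSum _ fun i _ => continuous_const.mul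
    (continuous_finsetSum _ fun j _ => (continuous_loss _ _).comp ?_))
  exact (RKHS.continuous_eval (H := HΘ) (node τ μ j)).comp
    (RKHS.continuous_eval (H := H) (S i).1)

theorem existsUnique_isSolution [CompleteSpace H] (μ : Measure τ.Hyper) {lam : ℝ} (hlam : 0 < lam)
    (m : ℕ) {n : ℕ} (S : Fin n → 𝒳 × ℝ) : ∃! h : H, IsSolution τ μ lam m S h :=
  existsUnique_ridge_minimizer hlam (continuous_sampledEmpiricalRisk μ m S)
    (sampledEmpiricalRisk_nonneg μ m S) (sampledEmpiricalRisk_midpoint_le μ m S)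

variable {B : ℝ} {μ : Measure τ.Hyper} {lam : ℝ} {m n : ℕ} {S : Fin n → 𝒳 × ℝ} {h : H}

theorem IsSolution.norm_le (hlam : 0 < lam) (hS : ∀ i, (S i).2 ∈ τ.outputs B)
    (hh : IsSolution τ μ lam m S h) : ‖h‖ ≤ √(2 * (|B| + 1)) / √lam := by
  refine norm_le_of_ridge_minimizer hlam (sampledEmpiricalRisk_nonneg μ m S) ?_ hh
  have hB : 0 ≤ |B| + 1 := by positivity
  have h1 := one_div_mul_sum_le (Finset.univ : Finset (Fin n))
    (fun i => sampledLoss τ μ m (S i).2 ((0 : H) (S i).1)) hB fun i _ => by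
      have h2 := one_div_mul_sum_le (Finset.range m)
        (fun j => τ.loss (node τ μ j) (S i).2 (((0 : H) (S i).1) (node τ μ j))) hB fun j _ => by
          simpa using loss_zero_le (hS i) (node τ μ j).2
      rwa [Finset.card_range] at h2
  rwa [Finset.card_univ, Fintype.card_fin] at h1

variable [CompleteSpace HΘ] [CompleteSpace H] {kX : 𝒳 → 𝒳 → ℝ} {kΘ : ℝ → ℝ → ℝ} {κX κΘ D : ℝ}

theorem norm_kerFun_one_le
    (hΘ : ∀ s t : τ.Hyper, RKHS.kernel HΘ s t = kΘ s t • ContinuousLinearMap.id ℝ ℝ)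
    (hκ : ∀ θ ∈ Set.Icc τ.lo τ.hi, kΘ θ θ ≤ κΘ ^ 2) (θ : τ.Hyper) :
    ‖RKHS.kerFun HΘ θ (1 : ℝ)‖ ≤ |κΘ| := by
  refine le_of_sq_le_sq ?_ (abs_nonneg _)
  rw [sq_abs, ← real_inner_self_eq_norm_sq, inner_kerFun_one, kerFun_one_apply hΘ]
  exact hκ θ θ.2

theorem abs_apply_le
    (hΘ : ∀ s t : τ.Hyper, RKHS.kernel HΘ s t = kΘ s t • ContinuousLinearMap.id ℝ ℝ)
    (hκ : ∀ θ ∈ Set.Icc τ.lo τ.hi, kΘ θ θ ≤ κΘ ^ 2) (f : HΘ) (θ : τ.Hyper) :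
    |f θ| ≤ ‖f‖ * |κΘ| := by
  rw [← inner_kerFun_one]
  exact (abs_real_inner_le_norm _ _).trans
    (mul_le_mul_of_nonneg_left (norm_kerFun_one_le hΘ hκ θ) (norm_nonneg _))

theorem abs_apply_sub_le
    (hΘ : ∀ s t : τ.Hyper, RKHS.kernel HΘ s t = kΘ s t • ContinuousLinearMap.id ℝ ℝ)
    (hD : ∀ s ∈ Set.Icc τ.lo τ.hi, ∀ t ∈ Set.Icc τ.lo τ.hi,
      kΘ s s + kΘ t t - 2 * kΘ s t ≤ D ^ 2 * (s - t) ^ 2) (f : HΘ) (s t : τ.Hyper) :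
    |f s - f t| ≤ ‖f‖ * |D| * |(s : ℝ) - t| := by
  have h1 : ‖RKHS.kerFun HΘ s (1 : ℝ) - RKHS.kerFun HΘ t (1 : ℝ)‖ ≤ |D| * |(s : ℝ) - t| := by
    refine le_of_sq_le_sq ?_ (by positivity)
    rw [norm_sub_sq_real, ← real_inner_self_eq_norm_sq, ← real_inner_self_eq_norm_sq]
    simp only [inner_kerFun_one, kerFun_one_apply hΘ]
    rw [mul_pow, sq_abs, sq_abs]
    have := hD s s.2 t t.2
    rw [kernel_symm hΘ t s]
    linarith
  rw [← inner_kerFun_one f s, ← inner_kerFun_one f t, ← inner_sub_right, mul_assoc]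
  exact (abs_real_inner_le_norm _ _).trans (mul_le_mul_of_nonneg_left h1 (norm_nonneg _))

theorem kerFun_eval
    (hX : ∀ x z : 𝒳, RKHS.kernel H x z = kX x z • ContinuousLinearMap.id ℝ HΘ)
    (x z : 𝒳) (w : HΘ) : RKHS.kerFun H z w x = kX x z • w := by
  rw [RKHS.kerFun_apply, hX]; simp

theorem norm_kerFun_apply_le
    (hX : ∀ x z : 𝒳, RKHS.kernel H x z = kX x z • ContinuousLinearMap.id ℝ HΘ)
    (hκ : ∀ x, kX x x ≤ κX ^ 2) (x : 𝒳) (w : HΘ) : ‖RKHS.kerFun H x w‖ ≤ |κX| * ‖w‖ := by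
  refine le_of_sq_le_sq ?_ (by positivity)
  rw [← real_inner_self_eq_norm_sq, RKHS.inner_kerFun, kerFun_eval hX, real_inner_smul_left,
    real_inner_self_eq_norm_sq, mul_pow, sq_abs]
  exact mul_le_mul_of_nonneg_right (hκ x) (sq_nonneg _)

theorem norm_apply_le_mul
    (hX : ∀ x z : 𝒳, RKHS.kernel H x z = kX x z • ContinuousLinearMap.id ℝ HΘ)
    (hκ : ∀ x, kX x x ≤ κX ^ 2) (h : H) (x : 𝒳) : ‖h x‖ ≤ |κX| * ‖h‖ := by
  have h1 : ‖h x‖ ^ 2 ≤ ‖h‖ * (|κX| * ‖h x‖) := by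
    rw [← real_inner_self_eq_norm_sq, ← RKHS.inner_kerFun]
    exact (real_inner_le_norm _ _).trans
      (mul_le_mul_of_nonneg_left (norm_kerFun_apply_le hX hκ x _) (norm_nonneg _))
  rcases (norm_nonneg (h x)).eq_or_lt with h0 | h0
  · rw [← h0]; positivity
  · refine le_of_mul_le_mul_right ?_ h0
    linarith

theorem abs_kX_mul_le
    (hX : ∀ x z : 𝒳, RKHS.kernel H x z = kX x z • ContinuousLinearMap.id ℝ HΘ)
    (hκ : ∀ x, kX x x ≤ κX ^ 2) (x z : 𝒳) (w : HΘ) (θ : τ.Hyper) :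
    |RKHS.kerFun H z w x θ| ≤ κX ^ 2 * |w θ| := by
  rw [kerFun_eval hX, RKHS.coe_smul, Pi.smul_apply, smul_eq_mul, abs_mul]
  rcases eq_or_ne w 0 with rfl | hw
  · simp
  refine mul_le_mul_of_nonneg_right ?_ (abs_nonneg _)
  have hw0 : 0 < ‖w‖ ^ 2 := by positivity
  refine le_of_mul_le_mul_right ?_ hw0
  have e : inner ℝ (RKHS.kerFun H z w) (RKHS.kerFun H x w) = kX x z * ‖w‖ ^ 2 := by
    rw [RKHS.inner_kerFun, kerFun_eval hX, real_inner_smul_left, real_inner_self_eq_norm_sq]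
  calc |kX x z| * ‖w‖ ^ 2 = |inner ℝ (RKHS.kerFun H z w) (RKHS.kerFun H x w)| := by
        rw [e, abs_mul, abs_of_pos hw0]
    _ ≤ (|κX| * ‖w‖) * (|κX| * ‖w‖) := (abs_real_inner_le_norm _ _).trans
        (mul_le_mul (norm_kerFun_apply_le hX hκ z w) (norm_kerFun_apply_le hX hκ x w)
          (norm_nonneg _) (by positivity))
    _ = κX ^ 2 * ‖w‖ ^ 2 := by rw [← sq_abs κX]; ring

/-- The values of the solution are dominated by the supremum norm. -/
theorem IsSolution.abs_inner_le
    (hX : ∀ x z : 𝒳, RKHS.kernel H x z = kX x z • ContinuousLinearMap.id ℝ HΘ)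
    (hκ : ∀ x, kX x x ≤ κX ^ 2) (hlam : 0 < lam) (hS : ∀ i, (S i).2 ∈ τ.outputs B)
    (hh : IsSolution τ μ lam m S h) (x : 𝒳) (w : HΘ) (W : ℝ) (hw : ∀ θ : τ.Hyper, |w θ| ≤ W) :
    |inner ℝ (h x) w| ≤ κX ^ 2 / lam * W := by
  have hW : 0 ≤ W := (abs_nonneg _).trans (hw ⟨τ.lo, le_rfl, τ.lo_le_hi⟩)
  have h1 := abs_inner_le_of_ridge_minimizer (C := κX ^ 2 * W) hlam hh (g := RKHS.kerFun H x w)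
    fun t => by
      have hC : 0 ≤ |t| * (κX ^ 2 * W) := by positivity
      have hterm : ∀ (i : Fin n) (j : ℕ),
          τ.loss (node τ μ j) (S i).2 ((h + t • RKHS.kerFun H x w) (S i).1 (node τ μ j)) -
            τ.loss (node τ μ j) (S i).2 (h (S i).1 (node τ μ j)) ≤ |t| * (κX ^ 2 * W) :=
        fun i j => by
          refine (le_of_abs_le (abs_loss_sub_le (hS i) (node τ μ j).2 _ _)).trans ?_
          simp only [RKHS.coe_add, RKHS.coe_smul, Pi.add_apply, Pi.smul_apply, smul_eq_mul,
            add_sub_cancel_left]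
          rw [abs_mul]
          exact mul_le_mul_of_nonneg_left ((abs_kX_mul_le hX hκ _ _ _ _).trans
            (mul_le_mul_of_nonneg_left (hw _) (sq_nonneg _))) (abs_nonneg _)
      unfold sampledEmpiricalRisk
      rw [← mul_sub, ← Finset.sum_sub_distrib]
      have h2 := one_div_mul_sum_le (Finset.univ : Finset (Fin n)) (fun i =>
        sampledLoss τ μ m (S i).2 ((h + t • RKHS.kerFun H x w) (S i).1) -
          sampledLoss τ μ m (S i).2 (h (S i).1)) hC fun i _ => by
        unfold sampledLoss
        rw [← mul_sub, ← Finset.sum_sub_distrib]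
        have h3 := one_div_mul_sum_le (Finset.range m) _ hC fun j _ => hterm i j
        rwa [Finset.card_range] at h3
      rwa [Finset.card_univ, Fintype.card_fin] at h2
  rw [RKHS.inner_kerFun] at h1
  refine h1.trans (le_of_eq ?_)
  ring

end Hypotheses

section Generalization

variable {𝒳 HΘ H : Type*} {τ : Task} [MeasurableSpace 𝒳]
  [NormedAddCommGroup HΘ] [InnerProductSpace ℝ HΘ] [RKHS ℝ HΘ τ.Hyper ℝ]
  [NormedAddCommGroup H] [InnerProductSpace ℝ H] [RKHS ℝ H 𝒳 HΘ]
  [CompleteSpace HΘ] [CompleteSpace H] {kX : 𝒳 → 𝒳 → ℝ} {kΘ : ℝ → ℝ → ℝ} {κX κΘ B : ℝ}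

/-- Uniform deviation, for one hyperparameter, of the empirical from the true risk. -/
theorem exists_uniform_deviation_loss (P : Measure (𝒳 × ℝ)) [IsProbabilityMeasure P]
    (hΘ : ∀ s t : τ.Hyper, RKHS.kernel HΘ s t = kΘ s t • ContinuousLinearMap.id ℝ ℝ)
    (hX : ∀ x z : 𝒳, RKHS.kernel H x z = kX x z • ContinuousLinearMap.id ℝ HΘ)
    (hXm : Measurable (Function.uncurry kX)) (hκX : ∀ x, kX x x ≤ κX ^ 2)
    (hκΘ : ∀ θ ∈ Set.Icc τ.lo τ.hi, kΘ θ θ ≤ κΘ ^ 2) (hP : ∀ᵐ z ∂P, z.2 ∈ τ.outputs B)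
    {ρ : ℝ} (hρ : 0 < ρ) (n : ℕ) (θ : τ.Hyper) :
    ∃ Φ : (Fin n → 𝒳 × ℝ) → ENNReal, Measurable Φ ∧
      ∫⁻ S, Φ S ∂(Measure.pi fun _ => P) ≤
        ENNReal.ofReal (2 * (√n * (ρ * (|κX| * |κΘ|) + (|B| + 1)))) ∧
      ∀ S : Fin n → 𝒳 × ℝ, (∀ i, (S i).2 ∈ τ.outputs B) → ∀ h : H, ‖h‖ ≤ ρ →
        ENNReal.ofReal (n * ∫ z, τ.loss θ z.2 (h z.1 θ) ∂P -
          ∑ i, τ.loss θ (S i).2 (h (S i).1 θ)) ≤ Φ S := by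
  classical
  set ψ : 𝒳 × ℝ → H := fun z => RKHS.kerFun H z.1 (RKHS.kerFun HΘ θ (1 : ℝ)) with hψ
  set φ : 𝒳 × ℝ → ℝ → ℝ := fun z t => if z.2 ∈ τ.outputs B then τ.loss θ z.2 t else 0 with hφ
  have hinner : ∀ (h : H) (z : 𝒳 × ℝ), inner ℝ h (ψ z) = h z.1 θ := fun h z => by
    rw [hψ, RKHS.inner_kerFun, inner_kerFun_one]
  have hψm : Measurable fun p : (𝒳 × ℝ) × (𝒳 × ℝ) => inner ℝ (ψ p.1) (ψ p.2) := by
    have e : ∀ p : (𝒳 × ℝ) × (𝒳 × ℝ), inner ℝ (ψ p.1) (ψ p.2) =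
        kX p.2.1 p.1.1 * RKHS.kerFun HΘ θ (1 : ℝ) θ := fun p => by
      rw [hinner, hψ]
      simp only
      rw [kerFun_eval hX, RKHS.coe_smul, Pi.smul_apply, smul_eq_mul]
    simp only [e]
    exact (hXm.comp ((measurable_fst.comp measurable_snd).prodMk
      (measurable_fst.comp measurable_fst))).mul_const _
  have hφm : Measurable (Function.uncurry φ) := by
    refine Measurable.ite (measurableSet_preimage (measurable_snd.comp measurable_fst)
      (measurableSet_outputs τ B)) ?_ measurable_const
    exact (measurable_loss (τ := τ) θ).comp
      ((measurable_snd.comp measurable_fst).prodMk measurable_snd)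
  have hψb : ∀ z, ‖ψ z‖ ≤ |κX| * |κΘ| := fun z =>
    (norm_kerFun_apply_le hX hκX _ _).trans
      (mul_le_mul_of_nonneg_left (norm_kerFun_one_le hΘ hκΘ θ) (abs_nonneg _))
  have hφl : ∀ z x y, |φ z x - φ z y| ≤ |x - y| := fun z x y => by
    simp only [hφ]
    split_ifs with h
    · exact abs_loss_sub_le h θ.2 x y
    · simp
  have hφ0 : ∀ z, |φ z 0| ≤ |B| + 1 := fun z => by
    simp only [hφ]
    split_ifs with h
    · rw [abs_of_nonneg (loss_nonneg θ.2 _ _)]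
      exact loss_zero_le h θ.2
    · simp; positivity
  obtain ⟨Φ, hΦm, hΦi, hΦ⟩ := exists_uniform_deviation P hψm hφm (by positivity) hψb hρ hφl
    (by positivity) hφ0 n
  refine ⟨Φ, hΦm, hΦi, fun S hS h hh => ?_⟩
  have h1 := hΦ S h hh
  simp only [hinner] at h1
  have e1 : ∫ z, φ z (h z.1 θ) ∂P = ∫ z, τ.loss θ z.2 (h z.1 θ) ∂P :=
    integral_congr_ae (by filter_upwards [hP] with z hz; simp [hφ, hz])
  have e2 : ∀ i, φ (S i) (h (S i).1 θ) = τ.loss θ (S i).2 (h (S i).1 θ) := fun i => by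
    simp [hφ, hS i]
  simpa only [e1, e2] using h1

theorem integrable_loss_apply (P : Measure (𝒳 × ℝ)) [IsProbabilityMeasure P]
    (hΘ : ∀ s t : τ.Hyper, RKHS.kernel HΘ s t = kΘ s t • ContinuousLinearMap.id ℝ ℝ)
    (hX : ∀ x z : 𝒳, RKHS.kernel H x z = kX x z • ContinuousLinearMap.id ℝ HΘ)
    (hXm : Measurable (Function.uncurry kX)) (hκX : ∀ x, kX x x ≤ κX ^ 2)
    (hκΘ : ∀ θ ∈ Set.Icc τ.lo τ.hi, kΘ θ θ ≤ κΘ ^ 2) (hP : ∀ᵐ z ∂P, z.2 ∈ τ.outputs B)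
    (h : H) (θ : τ.Hyper) : Integrable (fun z : 𝒳 × ℝ => τ.loss θ z.2 (h z.1 θ)) P := by
  have hm : Measurable fun x : 𝒳 => h x θ := by
    have := measurable_inner_feature
      (ψ := fun x : 𝒳 => RKHS.kerFun H x (RKHS.kerFun HΘ θ (1 : ℝ))) (by
        have e : ∀ p : 𝒳 × 𝒳, inner ℝ (RKHS.kerFun H p.1 (RKHS.kerFun HΘ θ (1 : ℝ)))
            (RKHS.kerFun H p.2 (RKHS.kerFun HΘ θ (1 : ℝ))) =
            kX p.2 p.1 * RKHS.kerFun HΘ θ (1 : ℝ) θ := fun p => by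
          rw [RKHS.inner_kerFun, kerFun_eval hX, real_inner_smul_left, inner_kerFun_one]
        simp only [e]
        exact (hXm.comp (measurable_snd.prodMk measurable_fst)).mul_const _) h
    have e : ∀ x, inner ℝ h (RKHS.kerFun H x (RKHS.kerFun HΘ θ (1 : ℝ))) = h x θ := fun x => by
      rw [RKHS.inner_kerFun, inner_kerFun_one]
    simpa only [e] using this
  refine Integrable.of_bound ((measurable_loss (τ := τ) θ).comp
    (measurable_snd.prodMk (hm.comp measurable_fst))).aestronglyMeasurable
    (|B| + 1 + |κX| * ‖h‖ * |κΘ|) ?_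
  filter_upwards [hP] with z hz
  rw [Real.norm_eq_abs, abs_of_nonneg (loss_nonneg θ.2 _ _)]
  refine (loss_le hz θ.2).trans (add_le_add_right ?_ _)
  exact (abs_apply_le hΘ hκΘ _ _).trans
    (mul_le_mul_of_nonneg_right (norm_apply_le_mul hX hκX h z.1) (abs_nonneg _))

theorem risk_le_of_quadrature (P : Measure (𝒳 × ℝ)) [IsProbabilityMeasure P]
    (hΘ : ∀ s t : τ.Hyper, RKHS.kernel HΘ s t = kΘ s t • ContinuousLinearMap.id ℝ ℝ)
    (hX : ∀ x z : 𝒳, RKHS.kernel H x z = kX x z • ContinuousLinearMap.id ℝ HΘ)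
    (hXm : Measurable (Function.uncurry kX)) (hκX : ∀ x, kX x x ≤ κX ^ 2)
    (hκΘ : ∀ θ ∈ Set.Icc τ.lo τ.hi, kΘ θ θ ≤ κΘ ^ 2) (hP : ∀ᵐ z ∂P, z.2 ∈ τ.outputs B)
    (μ : Measure τ.Hyper) (m : ℕ) {h : H} {q : ℝ}
    (hq : ∀ x, ∀ y ∈ τ.outputs B, integratedLoss τ μ y (h x) ≤ sampledLoss τ μ m y (h x) + q) :
    risk τ μ P h ≤ (1 / m : ℝ) * ∑ j ∈ Finset.range m,
      ∫ z, τ.loss (node τ μ j) z.2 (h z.1 (node τ μ j)) ∂P + q := by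
  have hintegr : ∀ j, Integrable (fun z : 𝒳 × ℝ => τ.loss (node τ μ j) z.2 (h z.1 (node τ μ j))) P :=
    fun j => integrable_loss_apply P hΘ hX hXm hκX hκΘ hP h _
  have hsum : Integrable (fun z : 𝒳 × ℝ => sampledLoss τ μ m z.2 (h z.1)) P :=
    (integrable_finsetSum _ fun j _ => hintegr j).const_mul _
  calc risk τ μ P h ≤ ∫ z, (sampledLoss τ μ m z.2 (h z.1) + q) ∂P := by
        refine integral_mono_of_nonneg
          (Filter.Eventually.of_forall fun z => integratedLoss_nonneg _ _ _)
          (hsum.add (integrable_const q)) ?_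
        filter_upwards [hP] with z hz using hq z.1 z.2 hz
    _ = _ := by
        rw [integral_add hsum (integrable_const q)]
        unfold sampledLoss
        rw [integral_const_mul, integral_finsetSum _ fun j _ => hintegr j]
        simp

/-- A bound for the quadrature error of the solutions yields the generalization bound. -/
theorem measure_failure_le (P : Measure (𝒳 × ℝ)) [IsProbabilityMeasure P]
    (hΘ : ∀ s t : τ.Hyper, RKHS.kernel HΘ s t = kΘ s t • ContinuousLinearMap.id ℝ ℝ)
    (hX : ∀ x z : 𝒳, RKHS.kernel H x z = kX x z • ContinuousLinearMap.id ℝ HΘ)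
    (hXm : Measurable (Function.uncurry kX)) (hκX : ∀ x, kX x x ≤ κX ^ 2)
    (hκΘ : ∀ θ ∈ Set.Icc τ.lo τ.hi, kΘ θ θ ≤ κΘ ^ 2) (hP : ∀ᵐ z ∂P, z.2 ∈ τ.outputs B)
    (μ : Measure τ.Hyper) {m n : ℕ} (hm : 1 ≤ m) (hn : 1 ≤ n) {lam Λ δ q : ℝ} (hlam : 0 < lam)
    (hΛ : lam ≤ Λ) (hδ : 0 < δ)
    (hq : ∀ S : Fin n → 𝒳 × ℝ, (∀ i, (S i).2 ∈ τ.outputs B) → ∀ h : H, IsSolution τ μ lam m S h →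
      ∀ x, ∀ y ∈ τ.outputs B, integratedLoss τ μ y (h x) ≤ sampledLoss τ μ m y (h x) + q) :
    Measure.pi (fun _ : Fin n => P) {S | ∃ h : H, IsSolution τ μ lam m S h ∧
      ¬ (risk τ μ P h ≤ sampledEmpiricalRisk τ μ m S h +
        2 * (√(2 * (|B| + 1)) * (|κX| * |κΘ|) + (|B| + 1) * √Λ) / δ / √(lam * n) + q)} ≤
      ENNReal.ofReal δ := by
  set L₀ := |B| + 1 with hL₀
  have hL₀pos : 0 < L₀ := by positivity
  set ρ := √(2 * L₀) / √lam with hρdef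
  have hsl : 0 < √lam := Real.sqrt_pos.2 hlam
  have hρ : 0 < ρ := by positivity
  have hΛ0 : 0 < √Λ := Real.sqrt_pos.2 (hlam.trans_le hΛ)
  have hm0 : (0 : ℝ) < m := by exact_mod_cast hm
  have hn0 : (0 : ℝ) < n := by exact_mod_cast hn
  set C := 2 * (√(2 * L₀) * (|κX| * |κΘ|) + L₀ * √Λ) with hC
  have hCpos : 0 < C := by positivity
  set V := 2 * (√n * (ρ * (|κX| * |κΘ|) + L₀)) with hV
  have hV0 : 0 < V := by positivity
  choose Φ hΦm hΦi hΦ using fun j : ℕ => exists_uniform_deviation_loss P hΘ hX hXm hκX hκΘ hP hρ n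
    (node τ μ j)
  set t : ℝ := C / δ / √(lam * n) with ht
  have ht0 : 0 < t := by positivity
  have hVt : V ≤ δ * (n * t) := by
    have e : δ * (n * t) = C * √n / √lam := by
      rw [ht, Real.sqrt_mul hlam.le]
      have hsn : √(n : ℝ) ≠ 0 := (Real.sqrt_pos.2 hn0).ne'
      field_simp
      rw [Real.sq_sqrt hn0.le]
    rw [e, le_div_iff₀ hsl, hV, hC, hρdef]
    have h1 : √lam ≤ √Λ := Real.sqrt_le_sqrt hΛ
    have e2 : 2 * (√n * (√(2 * L₀) / √lam * (|κX| * |κΘ|) + L₀)) * √lam =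
        2 * (√(2 * L₀) * (|κX| * |κΘ|) + L₀ * √lam) * √n := by field_simp
    rw [e2]
    gcongr
  have hmarkov : Measure.pi (fun _ : Fin n => P)
      {S | ENNReal.ofReal (m * (n * t)) ≤ ∑ j ∈ Finset.range m, Φ j S} ≤ ENNReal.ofReal δ := by
    have hmeas : Measurable fun S => ∑ j ∈ Finset.range m, Φ j S :=
      Finset.measurable_sum _ fun j _ => hΦm j
    refine (meas_ge_le_lintegral_div hmeas.aemeasurable
      (ENNReal.ofReal_pos.2 (by positivity)).ne' ENNReal.ofReal_ne_top).trans ?_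
    refine ENNReal.div_le_of_le_mul ?_
    rw [lintegral_finsetSum _ fun j _ => hΦm j]
    refine (Finset.sum_le_sum fun j _ => hΦi j).trans ?_
    rw [Finset.sum_const, Finset.card_range, nsmul_eq_mul, ← ENNReal.ofReal_natCast,
      ← ENNReal.ofReal_mul hm0.le, ← ENNReal.ofReal_mul hδ.le]
    refine ENNReal.ofReal_le_ofReal ?_
    calc (m : ℝ) * V ≤ m * (δ * (n * t)) := mul_le_mul_of_nonneg_left hVt hm0.le
      _ = δ * (m * (n * t)) := by ring
  refine le_trans (measure_mono_ae ?_) hmarkov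
  have hae : ∀ᵐ S ∂Measure.pi (fun _ : Fin n => P), ∀ i, (S i).2 ∈ τ.outputs B :=
    Filter.eventually_all.2 fun i =>
      (Measure.tendsto_eval_ae_ae (μ := fun _ : Fin n => P) (i := i)).eventually hP
  filter_upwards [hae] with S hS hbad
  obtain ⟨h, hsol, hfail⟩ := hbad
  have hnorm : ‖h‖ ≤ ρ := hsol.norm_le hlam hS
  have hrisk := risk_le_of_quadrature P hΘ hX hXm hκX hκΘ hP μ m (hq S hS h hsol)
  set R : ℕ → ℝ := fun j => ∫ z, τ.loss (node τ μ j) z.2 (h z.1 (node τ μ j)) ∂P with hR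
  set E : ℕ → ℝ := fun j => ∑ i, τ.loss (node τ μ j) (S i).2 (h (S i).1 (node τ μ j)) with hE
  have hemp : sampledEmpiricalRisk τ μ m S h =
      (1 / n : ℝ) * ((1 / m : ℝ) * ∑ j ∈ Finset.range m, E j) := by
    unfold sampledEmpiricalRisk sampledLoss
    rw [← Finset.mul_sum, Finset.sum_comm]
  have hlt : m * (n * t) < ∑ j ∈ Finset.range m, (n * R j - E j) := by
    rw [not_le] at hfail
    have h1 : sampledEmpiricalRisk τ μ m S h + t < (1 / m : ℝ) * ∑ j ∈ Finset.range m, R j := by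
      linarith
    rw [hemp] at h1
    rw [Finset.sum_sub_distrib, ← Finset.mul_sum]
    have h2 := mul_lt_mul_of_pos_left h1 (mul_pos hm0 hn0)
    have e1 : (m : ℝ) * n * ((1 / n : ℝ) * ((1 / m : ℝ) * ∑ j ∈ Finset.range m, E j) + t) =
        ∑ j ∈ Finset.range m, E j + m * (n * t) := by field_simp
    have e2 : (m : ℝ) * n * ((1 / m : ℝ) * ∑ j ∈ Finset.range m, R j) =
        n * ∑ j ∈ Finset.range m, R j := by field_simp
    rw [e1, e2] at h2
    linarith
  show ENNReal.ofReal (m * (n * t)) ≤ ∑ j ∈ Finset.range m, Φ j S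
  calc ENNReal.ofReal (m * (n * t)) ≤ ENNReal.ofReal (∑ j ∈ Finset.range m, (n * R j - E j)) :=
        ENNReal.ofReal_le_ofReal hlt.le
    _ ≤ ∑ j ∈ Finset.range m, ENNReal.ofReal (n * R j - E j) := by
        refine Finset.le_sum_of_subadditive ENNReal.ofReal ENNReal.ofReal_zero.le
          (fun _ _ => ENNReal.ofReal_add_le) _ _
    _ ≤ _ := Finset.sum_le_sum fun j _ => hΦ j S hS h hnorm

end Generalization

end InfiniteTask

end

open MeasureTheory InfiniteTask in
theorem mainTheorem1 (τ : Task) (κX κΘ B D Λ : ℝ) :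
    ∃ (C₁ : ℝ → ℝ) (C₂ : ℝ),
      ∀ (𝒳 : Type*) [MeasurableSpace 𝒳] (P : Measure (𝒳 × ℝ)) [IsProbabilityMeasure P]
        (kX : 𝒳 → 𝒳 → ℝ) (kΘ : ℝ → ℝ → ℝ)
        (HΘ : Type*) [NormedAddCommGroup HΘ] [InnerProductSpace ℝ HΘ] [CompleteSpace HΘ]
        [RKHS ℝ HΘ τ.Hyper ℝ]
        (H : Type*) [NormedAddCommGroup H] [InnerProductSpace ℝ H] [CompleteSpace H]
        [RKHS ℝ H 𝒳 HΘ],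
        -- `HΘ` is the RKHS of `kΘ`, and `H` the vector-valued RKHS of `kX · I`
        (∀ s t : τ.Hyper, RKHS.kernel HΘ s t = kΘ s t • ContinuousLinearMap.id ℝ ℝ) →
        (∀ x z : 𝒳, RKHS.kernel H x z = kX x z • ContinuousLinearMap.id ℝ HΘ) →
        -- bounded kernels, bounded output, measurable `kX`, and `kΘ` of class `C¹`
        Measurable (Function.uncurry kX) →
        (∀ x, kX x x ≤ κX ^ 2) →
        (∀ θ ∈ Set.Icc τ.lo τ.hi, kΘ θ θ ≤ κΘ ^ 2) →
        ContDiffOn ℝ 1 (Function.uncurry kΘ) (Set.Icc τ.lo τ.hi ×ˢ Set.Icc τ.lo τ.hi) →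
        (∀ᵐ z ∂P, z.2 ∈ τ.outputs B) →
        -- the regularized problem has exactly one solution
        (∀ (μ : Measure τ.Hyper) [IsProbabilityMeasure μ] (lam : ℝ), 0 < lam →
          ∀ (m n : ℕ) (S : Fin n → 𝒳 × ℝ), ∃! h : H, IsSolution τ μ lam m S h) ∧
        -- the bound for uniform `μ`, as `n, m → ∞`, with constants that do not depend on `lam`
        (∀ lam : ℝ, 0 < lam → lam ≤ Λ → ∃ M : ℕ, ∀ m ≥ M, ∀ n ≥ 1, ∀ δ : ℝ, 0 < δ →
          Measure.pi (fun _ : Fin n => P)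
            {S | ∃ h : H, IsSolution τ τ.uniform lam m S h ∧
              ¬ (risk τ τ.uniform P h ≤ sampledEmpiricalRisk τ τ.uniform m S h
                + C₁ δ / √(lam * n) + C₂ * (Real.log m / (√lam * m)))}
            ≤ ENNReal.ofReal δ) ∧
        -- the bound for any `μ` and uniformly in `lam`, if `θ ↦ kΘ(θ, ·)` is Lipschitz
        ((∀ s ∈ Set.Icc τ.lo τ.hi, ∀ t ∈ Set.Icc τ.lo τ.hi,
            kΘ s s + kΘ t t - 2 * kΘ s t ≤ D ^ 2 * (s - t) ^ 2) →
          ∀ (μ : Measure τ.Hyper) [IsProbabilityMeasure μ] (lam : ℝ), 0 < lam → lam ≤ Λ →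
          ∀ m ≥ 2, ∀ n ≥ 1, ∀ δ : ℝ, 0 < δ →
            Measure.pi (fun _ : Fin n => P)
              {S | ∃ h : H, IsSolution τ μ lam m S h ∧
                ¬ (risk τ μ P h ≤ sampledEmpiricalRisk τ μ m S h
                  + C₁ δ / √(lam * n) + C₂ * (Real.log m / (√lam * m)))}
              ≤ ENNReal.ofReal δ) := by
  set r := √(2 * (|B| + 1)) with hr
  set L₀ := |B| + 1 with hL₀
  have hL₀pos : 0 < L₀ := by positivity
  have hr0 : 0 ≤ r := Real.sqrt_nonneg _
  refine ⟨fun δ => 2 * (r * (|κX| * |κΘ|) + L₀ * √Λ) / δ,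
    ((3 * L₀ + 4) * √Λ + 3 * (|κX| * r * |κΘ|)) +
      12 * (2 * (|κX| * r * |D|) + L₀ * √Λ + |κX| * r * |κΘ|), ?_⟩
  intro 𝒳 _ P _ kX kΘ HΘ _ _ _ _ H _ _ _ _ hΘ hX hXm hκX hκΘ hk hP
  have habs : ∀ {lam : ℝ}, 0 < lam → ∀ {μ : Measure τ.Hyper} {m n : ℕ} {S : Fin n → 𝒳 × ℝ} {h : H},
      (∀ i, (S i).2 ∈ τ.outputs B) → IsSolution τ μ lam m S h →
      ∀ x, ‖h x‖ ≤ |κX| * r / √lam := fun hlam _ _ _ _ _ hS hsol x => by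
    rw [mul_div_assoc]
    exact (norm_apply_le_mul hX hκX _ x).trans
      (mul_le_mul_of_nonneg_left (hsol.norm_le hlam hS) (abs_nonneg _))
  have hscale : ∀ {lam : ℝ}, 0 < lam → lam ≤ Λ → 1 ≤ √Λ / √lam := fun hlam hΛ => by
    rw [one_le_div (Real.sqrt_pos.2 hlam)]
    exact Real.sqrt_le_sqrt hΛ
  refine ⟨fun μ _ lam hlam m n S => existsUnique_isSolution μ hlam m S,
    fun lam hlam hΛ => ?_, fun hD μ _ lam hlam hΛ m hm n hn δ hδ => ?_⟩
  · have hsl : 0 < √lam := Real.sqrt_pos.2 hlam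
    obtain ⟨M, hM1, hM⟩ := exists_integratedLoss_uniform_le hΘ hk B
      (A := κX ^ 2 / lam) (F := |κX| * r / √lam * |κΘ|) (by positivity) (by positivity)
    refine ⟨M, fun m hm n hn δ hδ => ?_⟩
    have hm1 : 1 ≤ m := hM1.trans hm
    refine measure_failure_le P hΘ hX hXm hκX hκΘ hP τ.uniform hm1 hn hlam hΛ hδ
      fun S hS h hsol x y hy => ?_
    have h1 := hM m hm (h x) (fun θ => (abs_apply_le hΘ hκΘ _ θ).trans
      (mul_le_mul_of_nonneg_right (habs hlam hS hsol x) (abs_nonneg _)))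
      (fun w W hw => hsol.abs_inner_le hX hκX hlam hS x w W hw) y hy
    refine h1.trans (add_le_add_right ?_ _)
    have hlog : 0 ≤ Real.log m / m := div_nonneg (Real.log_natCast_nonneg m) (by positivity)
    have hmove : ∀ c : ℝ, c * (Real.log m / (√lam * m)) = c / √lam * (Real.log m / m) :=
      fun c => by ring
    rw [hmove]
    refine mul_le_mul_of_nonneg_right ?_ hlog
    have h2 := hscale hlam hΛ
    have h3 : 0 ≤ 12 * (2 * (|κX| * r * |D|) + L₀ * √Λ + |κX| * r * |κΘ|) / √lam := by positivity
    have h4 : 3 * (L₀ + |κX| * r / √lam * |κΘ|) + 4 ≤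
        (3 * L₀ + 4) * (√Λ / √lam) + 3 * (|κX| * r / √lam * |κΘ|) := by nlinarith
    have e : ((3 * L₀ + 4) * √Λ + 3 * (|κX| * r * |κΘ|) +
        12 * (2 * (|κX| * r * |D|) + L₀ * √Λ + |κX| * r * |κΘ|)) / √lam =
        (3 * L₀ + 4) * (√Λ / √lam) + 3 * (|κX| * r / √lam * |κΘ|) +
          12 * (2 * (|κX| * r * |D|) + L₀ * √Λ + |κX| * r * |κΘ|) / √lam := by ring
    rw [e]
    linarith
  · have hsl : 0 < √lam := Real.sqrt_pos.2 hlam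
    refine measure_failure_le P hΘ hX hXm hκX hκΘ hP μ (by omega) hn hlam hΛ hδ
      fun S hS h hsol x y hy => ?_
    have hnx := habs hlam hS hsol x
    have h1 := integratedLoss_le_of_lipschitz μ hm hy (f := h x)
      (F := |κX| * r / √lam * |κΘ|) (L := |κX| * r / √lam * |D|) (by positivity)
      (fun θ => (abs_apply_le hΘ hκΘ _ θ).trans (mul_le_mul_of_nonneg_right hnx (abs_nonneg _)))
      (fun s t => (abs_apply_sub_le hΘ hD _ s t).trans (by gcongr))
    refine h1.trans (add_le_add_right ?_ _)
    have hlog : 0 ≤ Real.log m / m := div_nonneg (Real.log_natCast_nonneg m) (by positivity)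
    have hmove : ∀ c : ℝ, c * (Real.log m / (√lam * m)) = c / √lam * (Real.log m / m) :=
      fun c => by ring
    rw [hmove]
    refine mul_le_mul_of_nonneg_right ?_ hlog
    have h2 := hscale hlam hΛ
    have h3 : 0 ≤ ((3 * L₀ + 4) * √Λ + 3 * (|κX| * r * |κΘ|)) / √lam := by positivity
    have h4 : L₀ ≤ L₀ * (√Λ / √lam) := le_mul_of_one_le_right hL₀pos.le h2
    have e : ((3 * L₀ + 4) * √Λ + 3 * (|κX| * r * |κΘ|) +
        12 * (2 * (|κX| * r * |D|) + L₀ * √Λ + |κX| * r * |κΘ|)) / √lam =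
        ((3 * L₀ + 4) * √Λ + 3 * (|κX| * r * |κΘ|)) / √lam +
        12 * (2 * (|κX| * r / √lam * |D|) + L₀ * (√Λ / √lam) + |κX| * r / √lam * |κΘ|) := by ring
    rw [e]
    linarith
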